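/- **Theorem.** Let $E$ be a finite state space and let $\mathbb D$ be the set of paths $\omega:[0,\infty)\to E$ that are constant on each interval $[t_n,t_{n+1})$ for some $0=t_0<t_1<\cdots$ with $t_n\nearrow\infty$, with coordinate maps $X_t$ and the $\sigma$-field they generate. Let $\{\mathbb P_x\}_{x\in E}$ be a continuous-time Markov chain on $\mathbb D$ with transition rates $q(x,y)\ge 0$ ($x\neq y$), and put $\mathbb P_\lambda=\sum_x\lambda(x)\mathbb P_x$ for a probability $\lambda$ on $E$. Assume that the chain is mixing: it has a unique stationary distribution $\pi$, and for every $\alpha\in(0,1)$ there is $T\ge0$ with $d_{\rm TV}(\mathrm{Law}_x(X_T),\pi)\le\alpha$ for all $x\in E$; the smallest such $T$ is denoted $T_{\rm mix}(\alpha)$. Let $A\subset E$ with $\pi(A)>0$, and let $H_A=\inf\{t\ge 0: X_t\in A\}$. For $m>0$, $\alpha>0$, $\beta\in(0,1)$, write $Z=_d\mathrm{Exp}(m,\alpha,\beta)$ if the random variable $Z$ is almost surely finite and nonnegative and, for all $t>0$, $$(1-\alpha)\,e^{-\frac{t}{(1-\beta)m}}\le \mathbb P(Z\ge t)\le(1+\alpha)\,e^{-\frac{t}{(1+\beta)m}}.$$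 There is a universal constant $C>0$ (independent of the chain, $A$, $\varepsilon$, $\delta$ and the initial law) such that the following holds. Let $0<\varepsilon<\delta<1/5$ satisfy $$\mathbb P_\pi\big(H_A\le T_{\rm mix}(\delta\varepsilon)\big)\le\delta\varepsilon .$$ Then there is a unique $t_\varepsilon(A)\in[0,\infty)$ with $\mathbb P_\pi(H_A\le t_\varepsilon(A))=\varepsilon$, and $t_\varepsilon(A)>0$. For a probability $\lambda$ on $E$ put $r_\lambda=\mathbb P_\lambda(H_A\le T_{\rm mix}(\delta\varepsilon))$. Then: 1. for every $\lambda$ there are real numbers $a,b$ with $|a|\le C\varepsilon$, $|b|\le C\delta$ such that, under $\mathbb P_\lambda$, $H_A=_d\mathrm{Exp}\big(t_\varepsilon(A)/\varepsilon,\;a+2r_\lambda,\;b\big)$ (in particular $0<b<1$); 2. $\mathbb E_\pi H_A<\infty$ and $\left|\dfrac{\varepsilon\,\mathbb E_\pi H_A}{t_\varepsilon(A)}-1\right|\le C\delta$; 3. for every $\lambda$ there are real numbers $a,b$ with $|a|\le C\varepsilon$, $|b|\le C\delta$ such that, under $\mathbb P_\lambda$, $H_A=_d\mathrm{Exp}\big(\mathbb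 E_\pi H_A,\;a+2r_\lambda,\;b\big)$. -/

import Mathlib

open MeasureTheory Filter Topology
open scoped NNReal ENNReal

noncomputable section

/-- The path space `D([0,∞), E)`: functions `ω : [0,∞) → E` for which there are times
`0 = t₀ < t₁ < t₂ < ⋯` increasing to `∞` such that `ω` is constant on each `[tₙ, tₙ₊₁)`. -/
structure CadlagPath (E : Type*) where
  toFun : ℝ≥0 → E
  exists_times : ∃ t : ℕ → ℝ≥0, t 0 = 0 ∧ StrictMono t ∧ Tendsto t atTop atTop ∧
    ∀ n, ∀ s ∈ Set.Ico (t n) (t (n + 1)), toFun s = toFun (t n)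

namespace CadlagPath

variable {E : Type*}

/-- The coordinate projection `X_t`. -/
def X (t : ℝ≥0) (ω : CadlagPath E) : E := ω.toFun t

/-- The σ-field on path space generated by all the projections `X_t`. -/
instance instMeasurableSpace [MeasurableSpace E] : MeasurableSpace (CadlagPath E) :=
  ⨆ t : ℝ≥0, MeasurableSpace.comap (X t) inferInstance

/-- The σ-field `F_T` generated by `X_s`, `0 ≤ s ≤ T`. -/
@[reducible]
def past [MeasurableSpace E] (T : ℝ≥0) : MeasurableSpace (CadlagPath E) :=
  ⨆ s : Set.Iic T, MeasurableSpace.comap (X (s : ℝ≥0)) inferInstance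

/-- The time shift `(Θ_T ω)(s) = ω(s + T)`. -/
def shift (T : ℝ≥0) (ω : CadlagPath E) : CadlagPath E where
  toFun s := ω.toFun (s + T)
  exists_times := by
    obtain ⟨t, h0, hmono, htend, hconst⟩ := ω.exists_times
    have hex : ∃ n, T < t n := (htend.eventually_gt_atTop T).exists
    classical
    set N := Nat.find hex with hN
    have hNT : T < t N := Nat.find_spec hex
    have hN0 : N ≠ 0 := by
      intro h
      rw [h, h0] at hNT
      exact absurd hNT (by simp)
    obtain ⟨M, hM⟩ := Nat.exists_eq_succ_of_ne_zero hN0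
    have hMT : t M ≤ T := not_lt.mp (Nat.find_min hex (m := M) (by omega))
    have hge : ∀ n, T < t (N + n) := fun n =>
      hNT.trans_le (hmono.monotone (Nat.le_add_right N n))
    refine ⟨fun n => t (M + n) - T, tsub_eq_zero_of_le (by simpa using hMT), ?_, ?_, ?_⟩
    · refine strictMono_nat_of_lt_succ fun n => ?_
      have h1 : T < t (M + (n + 1)) := by
        have := hge n
        rwa [hM, Nat.succ_add_eq_add_succ] at this
      have h2 : t (M + n) < t (M + (n + 1)) := hmono (by omega)
      rw [lt_tsub_iff_right, tsub_add_eq_max]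
      exact max_lt h2 h1
    · refine tendsto_atTop.2 fun b => ?_
      have : ∀ᶠ n in atTop, b + T ≤ t (M + n) :=
        (htend.comp (tendsto_add_atTop_nat M)).eventually_ge_atTop (b + T) |>.mono
          fun n hn => by simpa [add_comm] using hn
      exact this.mono fun n hn => le_tsub_of_add_le_right hn
    · intro n s hs
      have hup : s + T < t (M + n + 1) := lt_tsub_iff_right.1 hs.2
      have hlo : t (M + n) ≤ s + T := tsub_le_iff_right.1 hs.1
      have e1 := hconst (M + n) (s + T) ⟨hlo, hup⟩
      have hlt : t (M + n) < t (M + n + 1) := hmono (Nat.lt_succ_self _)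
      have hTlt : T < t (M + n + 1) := lt_of_le_of_lt (by simp) hup
      have e2 := hconst (M + n) (t (M + n) - T + T)
        ⟨le_tsub_add, by rw [tsub_add_eq_max]; exact max_lt hlt hTlt⟩
      exact e1.trans e2.symm

/-- The hitting time `H_A(ω) = inf {t ≥ 0 : ω(t) ∈ A}`, with value `∞` if `A` is never hit. -/
def hittingTime (A : Set E) (ω : CadlagPath E) : ℝ≥0∞ :=
  ⨅ (t : ℝ≥0) (_ : X t ω ∈ A), (t : ℝ≥0∞)

end CadlagPath

open CadlagPath

/-- `P = (P_x)_{x ∈ E}` is the continuous-time Markov chain with transition rates `q x y`, `x ≠ y`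
(the diagonal of `q` plays no role): each `P x` is a probability measure on path space,
`P x (X_0 = x) = 1`, `P x (X_h = y) / h → q x y` as `h ↓ 0` for `y ≠ x`, and the conditional law of
`X ∘ Θ_T` given `F_T` under `P x` is `P (X_T)`. -/
structure IsMarkovChain {E : Type*} [MeasurableSpace E] (q : E → E → ℝ)
    (P : E → Measure (CadlagPath E)) : Prop where
  rate_nonneg : ∀ x y, x ≠ y → 0 ≤ q x y
  isProbabilityMeasure : ∀ x, IsProbabilityMeasure (P x)
  start : ∀ x, P x {ω | X 0 ω = x} = 1
  rate : ∀ x y, x ≠ y →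
    Tendsto (fun h : ℝ≥0 => (P x).real {ω | X h ω = y} / (h : ℝ)) (𝓝[>] 0) (𝓝 (q x y))
  markov : ∀ (x : E) (T : ℝ≥0) (B : Set (CadlagPath E)), MeasurableSet[past T] B →
    ∀ S : Set (CadlagPath E), MeasurableSet S →
      P x (B ∩ shift T ⁻¹' S) = ∫⁻ ω in B, P (X T ω) S ∂(P x)

/-- The mixture `P_μ = ∑ₓ μ(x) P_x`: the chain with initial law `μ`. -/
def startedFrom {E : Type*} [Fintype E] [MeasurableSpace E] (P : E → Measure (CadlagPath E))
    (μ : PMF E) : Measure (CadlagPath E) :=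
  ∑ x, μ x • P x

/-- `π` is stationary: under `P_π`, the law of `X ∘ Θ_T` is the law of `X`, for all `T ≥ 0`. -/
def IsStationaryLaw {E : Type*} [Fintype E] [MeasurableSpace E] (P : E → Measure (CadlagPath E))
    (π : PMF E) : Prop :=
  ∀ T : ℝ≥0, (startedFrom P π).map (shift T) = startedFrom P π

/-- Total variation distance `(1/2) ∑ₛ |μ(s) - ν(s)|` of probability measures on a finite set. -/
def tvDist {E : Type*} [Fintype E] [MeasurableSpace E] (μ ν : Measure E) : ℝ :=
  (1 / 2) * ∑ s, |μ.real {s} - ν.real {s}|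

/-- `d_TV(Law_x(X_T), π) ≤ a` for every starting state `x`. -/
def MixedAt {E : Type*} [Fintype E] [MeasurableSpace E] (P : E → Measure (CadlagPath E))
    (π : PMF E) (a : ℝ) (T : ℝ≥0) : Prop :=
  ∀ x, tvDist ((P x).map (X T)) π.toMeasure ≤ a

/-- The chain is mixing, with unique stationary distribution `π`. -/
structure IsMixing {E : Type*} [Fintype E] [MeasurableSpace E] (P : E → Measure (CadlagPath E))
    (π : PMF E) : Prop where
  stationary : IsStationaryLaw P π
  unique : ∀ π' : PMF E, IsStationaryLaw P π' → π' = π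
  mixed : ∀ a ∈ Set.Ioo (0 : ℝ) 1, ∃ T : ℝ≥0, MixedAt P π a T

/-- The `a`-mixing time: the smallest `T ≥ 0` with `d_TV(Law_x(X_T), π) ≤ a` for all `x`. -/
def mixingTime {E : Type*} [Fintype E] [MeasurableSpace E] (P : E → Measure (CadlagPath E))
    (π : PMF E) (a : ℝ) : ℝ≥0 :=
  sInf {T : ℝ≥0 | MixedAt P π a T}

/-- `P_μ(H_A ≤ t)`. -/
def hitProb {E : Type*} [Fintype E] [MeasurableSpace E] (P : E → Measure (CadlagPath E))
    (μ : PMF E) (A : Set E) (t : ℝ≥0) : ℝ :=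
  (startedFrom P μ).real {ω | hittingTime A ω ≤ t}

/-- `E_μ[H_A]`, as an element of `[0,∞]`. -/
def meanHit {E : Type*} [Fintype E] [MeasurableSpace E] (P : E → Measure (CadlagPath E))
    (μ : PMF E) (A : Set E) : ℝ≥0∞ :=
  ∫⁻ ω, hittingTime A ω ∂(startedFrom P μ)

/-- `Z =_d Exp(m, α, β)` under the probability measure `ℙ`: here `m > 0`, `α > 0`, `β ∈ (0,1)`, the
random variable `Z ≥ 0` is almost surely finite, and for all `t > 0`
`(1 - α) e^{-t/((1-β)m)} ≤ ℙ(Z ≥ t) ≤ (1 + α) e^{-t/((1+β)m)}`. -/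
structure IsNearlyExp {Ω : Type*} [MeasurableSpace Ω] (ℙ : Measure Ω) (Z : Ω → ℝ≥0∞)
    (m α β : ℝ) : Prop where
  mean_pos : 0 < m
  alpha_pos : 0 < α
  beta_mem : β ∈ Set.Ioo (0 : ℝ) 1
  aemeasurable : AEMeasurable Z ℙ
  ae_finite : ∀ᵐ ω ∂ℙ, Z ω < ∞
  lower : ∀ t : ℝ, 0 < t →
    (1 - α) * Real.exp (-(t / ((1 - β) * m))) ≤ ℙ.real {ω | ENNReal.ofReal t ≤ Z ω}
  upper : ∀ t : ℝ, 0 < t →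
    ℙ.real {ω | ENNReal.ofReal t ≤ Z ω} ≤ (1 + α) * Real.exp (-(t / ((1 + β) * m)))

end

open CadlagPath

/-! ### Hitting times on path space -/

section Paths

variable {E : Type*}

namespace CadlagPath

/-! Write F(t) = P_π(H_A ≤ t), S = T_mix(δε), t = t_ε(A). Under the stationary law, the probability
of first hitting A in (r, r+h] decreases with r, because shifting forgets a constraint
(`IsStationaryLaw.hitProb_increment_le`). So F behaves like a concave function: it is continuous,
strictly increasing until it reaches its limit 1, and F(t)/t is nonincreasing. The last fact turns
F(S) ≤ δε = δF(t) into S ≤ δt: mixing is fast on the scale t.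

Upper tail: from any state, wait S to mix and then t. A block of length S + t is avoided with
probability at most 1 - ε + δε, and the Markov property iterates this bound.

Lower tail: let v_k be the probability of avoiding A up to time kt. To survive one more block, mix
for time S and then avoid A. What is lost is a hit during the mixing window. Conditioning on that
window at its own start would give no control, so one conditions a whole block earlier, at kt; since
t ≥ S, the chain has mixed by then. This gives a two-step recursion (`MixedAt.noHit_recursion`) in
which the loss is a small multiple of v_k, and v_k ≤ 2v_{k+1} makes it geometric
(`geometric_lower_bound`).

Mean: the uniform block bound gives E_π H_A ≤ (S+t)/(ε(1-δ)). For the lower bound, let K be the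
largest mean over starting states. Stationarity gives t(1-ε) ≤ εK, and mixing gives (1-δε)K ≤ S +
E_π H_A. Both tail estimates are proved for every m in the window around t/ε that these bounds
define (`MixedAt.isNearlyExp`), so m = t/ε and m = E_π H_A are covered together. -/

lemma exists_constant_right (ω : CadlagPath E) (s : ℝ≥0) :
    ∃ u, s < u ∧ ∀ r, s ≤ r → r < u → X r ω = X s ω := by
  obtain ⟨t, h0, -, htend, hconst⟩ := ω.exists_times
  have hex : ∃ n, s < t n := (htend.eventually_gt_atTop s).exists
  classical
  have hN0 : Nat.find hex ≠ 0 := by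
    intro h
    have h1 := Nat.find_spec hex
    rw [h, h0] at h1
    exact absurd h1 (by simp)
  obtain ⟨M, hM⟩ := Nat.exists_eq_succ_of_ne_zero hN0
  have hMs : t M ≤ s := not_lt.mp (Nat.find_min hex (m := M) (by omega))
  have hs : s < t (M + 1) := by
    have h1 := Nat.find_spec hex
    rwa [hM] at h1
  refine ⟨t (M + 1), hs, fun r h1 h2 => ?_⟩
  exact (hconst M r ⟨hMs.trans h1, h2⟩).trans (hconst M s ⟨hMs, hs⟩).symm

/-- Paths are constant just to the right of each time, so an infimum equal to t forces a visit at or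
before t. -/
lemma hittingTime_le_iff (A : Set E) (ω : CadlagPath E) (t : ℝ≥0) :
    hittingTime A ω ≤ t ↔ ∃ s ≤ t, X s ω ∈ A := by
  constructor
  · intro h
    by_contra! hne
    obtain ⟨u, hu, hc⟩ := ω.exists_constant_right t
    have : (u : ℝ≥0∞) ≤ hittingTime A ω := by
      refine le_iInf₂ fun s hs => ?_
      by_contra! hsu
      rcases le_total s t with h1 | h1
      · exact hne s h1 hs
      · rw [hc s h1 (by exact_mod_cast hsu)] at hs
        exact hne t le_rfl hs
    exact absurd (this.trans h) (by simpa using hu)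
  · rintro ⟨s, hs, hA⟩
    exact (iInf₂_le s hA).trans (by exact_mod_cast hs)

lemma X_shift (T s : ℝ≥0) (ω : CadlagPath E) : X s (shift T ω) = X (s + T) ω := rfl

/-- The event that `A` is not visited during `[0,t]`. -/
def noHit (A : Set E) (t : ℝ≥0) : Set (CadlagPath E) := {ω | hittingTime A ω ≤ t}ᶜ

lemma mem_noHit {A : Set E} {t : ℝ≥0} {ω : CadlagPath E} :
    ω ∈ noHit A t ↔ ∀ s ≤ t, X s ω ∉ A := by
  simp [noHit, hittingTime_le_iff]

lemma mem_noHit_iff_lt {A : Set E} {t : ℝ≥0} {ω : CadlagPath E} :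
    ω ∈ noHit A t ↔ (t : ℝ≥0∞) < hittingTime A ω := by
  simp [noHit]

lemma noHit_add (A : Set E) (t s : ℝ≥0) :
    noHit A (t + s) = noHit A t ∩ shift t ⁻¹' noHit A s := by
  ext ω
  simp only [Set.mem_inter_iff, Set.mem_preimage, mem_noHit, X_shift]
  constructor
  · exact fun h => ⟨fun r hr => h r (hr.trans (by simp)),
      fun r hr => h _ (by rw [add_comm t s]; gcongr)⟩
  · rintro ⟨h1, h2⟩ r hr
    rcases le_total r t with h | h
    · exact h1 r h
    · have := h2 (r - t) (tsub_le_iff_left.2 hr)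
      rwa [tsub_add_cancel_of_le h] at this

lemma noHit_anti (A : Set E) : Antitone (noHit A) := fun s t hst ω hω => by
  rw [mem_noHit] at hω ⊢
  exact fun r hr => hω r (hr.trans hst)

lemma hittingTime_le_add_shift (A : Set E) (T : ℝ≥0) (ω : CadlagPath E) :
    hittingTime A ω ≤ T + hittingTime A (shift T ω) := by
  unfold hittingTime
  rw [ENNReal.add_iInf]
  refine le_iInf fun s => ?_
  by_cases hs : X s (shift T ω) ∈ A
  · simp only [hs, iInf_pos]
    refine (iInf₂_le (s + T) hs).trans ?_
    rw [add_comm]; push_cast; rfl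
  · simp [hs]

lemma add_hittingTime_shift_le {A : Set E} {T : ℝ≥0} {ω : CadlagPath E} (h : ω ∈ noHit A T) :
    T + hittingTime A (shift T ω) ≤ hittingTime A ω := by
  refine le_iInf₂ fun s hs => ?_
  have hTs : T ≤ s := by
    by_contra! h1
    exact mem_noHit.1 h s h1.le hs
  have : hittingTime A (shift T ω) ≤ ((s - T : ℝ≥0) : ℝ≥0∞) :=
    iInf₂_le (s - T) (by rwa [X_shift, tsub_add_cancel_of_le hTs])
  calc (T : ℝ≥0∞) + hittingTime A (shift T ω) ≤ T + ((s - T : ℝ≥0) : ℝ≥0∞) := by gcongr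
    _ = s := by rw [← ENNReal.coe_add, add_tsub_cancel_of_le hTs]

variable [MeasurableSpace E]

lemma measurable_X (t : ℝ≥0) : Measurable (X t : CadlagPath E → E) :=
  Measurable.of_comap_le (le_iSup (fun t : ℝ≥0 => MeasurableSpace.comap (X t) _) t)

lemma measurable_past_X {s T : ℝ≥0} (h : s ≤ T) :
    Measurable[past T] (X s : CadlagPath E → E) :=
  Measurable.of_comap_le
    (le_iSup (fun s : Set.Iic T => MeasurableSpace.comap (X (E := E) (s : ℝ≥0)) _) ⟨s, h⟩)

lemma past_le (T : ℝ≥0) : past T ≤ (instMeasurableSpace : MeasurableSpace (CadlagPath E)) :=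
  iSup_le fun s => (measurable_X (s : ℝ≥0)).comap_le

lemma measurable_shift (T : ℝ≥0) : Measurable (shift T : CadlagPath E → CadlagPath E) := by
  refine Measurable.of_le_map (iSup_le fun t => ?_)
  rw [MeasurableSpace.comap_le_iff_le_map, MeasurableSpace.map_comp]
  exact (measurable_X (E := E) (t + T)).le_map

variable [DiscreteMeasurableSpace E]

lemma measurableSet_past_hit (A : Set E) (t : ℝ≥0) :
    MeasurableSet[past t] {ω : CadlagPath E | hittingTime A ω ≤ t} := by
  obtain ⟨D, hDc, hD⟩ := TopologicalSpace.exists_countable_dense ℝ≥0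
  -- A visit before t persists up to a dense time still below t. A visit at t itself may only
  -- persist beyond t, outside the past, so it is listed separately.
  have : {ω : CadlagPath E | hittingTime A ω ≤ t} =
      X t ⁻¹' A ∪ ⋃ r ∈ D ∩ Set.Iio t, X r ⁻¹' A := by
    ext ω
    simp only [Set.mem_ofPred_eq, hittingTime_le_iff, Set.mem_union, Set.mem_preimage,
      Set.mem_iUnion, exists_prop, Set.mem_inter_iff, Set.mem_Iio]
    constructor
    · rintro ⟨s, hs, hA⟩
      rcases hs.eq_or_lt with rfl | hs
      · exact Or.inl hA
      · obtain ⟨u, hu, hc⟩ := ω.exists_constant_right s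
        obtain ⟨r, hrD, hr⟩ := hD.exists_between (lt_min hu hs)
        refine Or.inr ⟨r, ⟨hrD, hr.2.trans_le (min_le_right _ _)⟩, ?_⟩
        rwa [hc r hr.1.le (hr.2.trans_le (min_le_left _ _))]
    · rintro (h | ⟨r, ⟨-, hr⟩, hA⟩)
      · exact ⟨t, le_rfl, h⟩
      · exact ⟨r, hr.le, hA⟩
  rw [this]
  refine MeasurableSet.union (measurable_past_X le_rfl (MeasurableSet.of_discrete)) ?_
  refine MeasurableSet.biUnion (hDc.mono Set.inter_subset_left) fun r hr => ?_
  exact measurable_past_X hr.2.le (MeasurableSet.of_discrete)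

lemma measurableSet_past_noHit (A : Set E) (t : ℝ≥0) : MeasurableSet[past t] (noHit A t) :=
  (measurableSet_past_hit A t).compl

lemma measurableSet_noHit (A : Set E) (t : ℝ≥0) : MeasurableSet (noHit A t) :=
  past_le t _ (measurableSet_past_noHit A t)

lemma measurable_hittingTime (A : Set E) :
    Measurable (hittingTime A : CadlagPath E → ℝ≥0∞) := by
  refine measurable_of_Iic fun c => ?_
  induction c with
  | top => simp
  | coe t => exact past_le t _ (measurableSet_past_hit A t)

end CadlagPath

end Paths

/-! ### Markov property and mixing -/

lemma pmf_sum_toReal {E : Type*} [Fintype E] (μ : PMF E) : ∑ x, (μ x).toReal = 1 := by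
  rw [← ENNReal.toReal_sum fun x _ => μ.apply_ne_top x, ← tsum_fintype (L := .unconditional _),
    μ.tsum_coe, ENNReal.toReal_one]

/-- The masses agree, so f may be replaced by f - 1/2, which is at most 1/2 in absolute value. -/
lemma abs_sum_mul_sub_le {E : Type*} [Fintype E] {f p r : E → ℝ} (hf : ∀ x, f x ∈ Set.Icc (0 : ℝ) 1)
    (hp : ∑ x, p x = 1) (hr : ∑ x, r x = 1) :
    |∑ x, p x * f x - ∑ x, r x * f x| ≤ (1 / 2) * ∑ x, |p x - r x| := by
  have : ∑ x, p x * f x - ∑ x, r x * f x = ∑ x, (p x - r x) * (f x - 1 / 2) := by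
    have h : ∑ x, (p x - r x) * (f x - 1 / 2) =
        ∑ x, p x * f x - ∑ x, r x * f x - (1 / 2) * (∑ x, p x - ∑ x, r x) := by
      rw [← Finset.sum_sub_distrib, ← Finset.sum_sub_distrib, Finset.mul_sum,
        ← Finset.sum_sub_distrib]
      exact Finset.sum_congr rfl fun x _ => by ring
    rw [h, hp, hr]; ring
  rw [this, Finset.mul_sum]
  refine (Finset.abs_sum_le_sum_abs _ _).trans (Finset.sum_le_sum fun x _ => ?_)
  rw [abs_mul, mul_comm]
  refine mul_le_mul_of_nonneg_right ?_ (abs_nonneg _)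
  rw [abs_le]
  constructor <;> linarith [(hf x).1, (hf x).2]

section Chains

variable {E : Type*} [Fintype E] [MeasurableSpace E] {q : E → E → ℝ}
  {P : E → Measure (CadlagPath E)} {π μ : PMF E} {A : Set E}

lemma IsMarkovChain.isProbabilityMeasure_startedFrom (hP : IsMarkovChain q P) (μ : PMF E) :
    IsProbabilityMeasure (startedFrom P μ) := by
  have := hP.isProbabilityMeasure
  constructor
  simp only [startedFrom, Measure.coe_finsetSum, Finset.sum_apply, Measure.smul_apply,
    measure_univ, smul_eq_mul, mul_one]
  rw [← tsum_fintype (L := .unconditional _), μ.tsum_coe]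

lemma IsMarkovChain.startedFrom_real (hP : IsMarkovChain q P) (μ : PMF E)
    (U : Set (CadlagPath E)) :
    (startedFrom P μ).real U = ∑ x, (μ x).toReal * (P x).real U := by
  have := hP.isProbabilityMeasure
  simp only [startedFrom, Measure.real, Measure.coe_finsetSum, Finset.sum_apply,
    Measure.smul_apply, smul_eq_mul]
  rw [ENNReal.toReal_sum fun x _ => ENNReal.mul_ne_top (μ.apply_ne_top x) (measure_ne_top _ _)]
  simp

lemma startedFrom_pure (P : E → Measure (CadlagPath E)) (x : E) :
    startedFrom P (PMF.pure x) = P x := by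
  classical
  simp only [startedFrom]
  rw [Finset.sum_eq_single x]
  · simp
  · intro y _ hy; simp [hy]
  · simp

lemma lintegral_startedFrom (P : E → Measure (CadlagPath E)) (μ : PMF E)
    (f : CadlagPath E → ℝ≥0∞) :
    ∫⁻ ω, f ω ∂(startedFrom P μ) = ∑ x, μ x * ∫⁻ ω, f ω ∂(P x) := by
  simp [startedFrom, lintegral_smul_measure]

lemma IsMarkovChain.le_startedFrom_real (hP : IsMarkovChain q P) (μ : PMF E)
    {U : Set (CadlagPath E)} {c : ℝ} (h : ∀ x, c ≤ (P x).real U) :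
    c ≤ (startedFrom P μ).real U := by
  rw [hP.startedFrom_real]
  calc c = ∑ x, (μ x).toReal * c := by rw [← Finset.sum_mul, pmf_sum_toReal, one_mul]
    _ ≤ _ := Finset.sum_le_sum fun x _ => mul_le_mul_of_nonneg_left (h x) ENNReal.toReal_nonneg

lemma IsStationaryLaw.real_preimage_shift (h : IsStationaryLaw P π) (T : ℝ≥0)
    {U : Set (CadlagPath E)} (hU : MeasurableSet U) :
    (startedFrom P π).real (shift T ⁻¹' U) = (startedFrom P π).real U := by
  conv_rhs => rw [← h T]
  rw [map_measureReal_apply (measurable_shift T) hU]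

variable [MeasurableSingletonClass E]

lemma measurableSet_X_eq (T : ℝ≥0) (y : E) : MeasurableSet {ω : CadlagPath E | X T ω = y} :=
  measurable_X T (MeasurableSet.of_discrete (s := {y}))

/-- The Markov property at time `T`, on an event of the past, as an identity of measures. -/
lemma IsMarkovChain.map_shift_restrict (hP : IsMarkovChain q P) (μ : PMF E) {T : ℝ≥0}
    {B : Set (CadlagPath E)} (hB : MeasurableSet[past T] B) :
    ((startedFrom P μ).restrict B).map (shift T) =
      ∑ y, startedFrom P μ (B ∩ {ω | X T ω = y}) • P y := by
  ext U hU
  have hB' := past_le T _ hB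
  have key : ∀ x, P x (shift T ⁻¹' U ∩ B) =
      ∑ y, P x (B ∩ {ω | X T ω = y}) * P y U := by
    intro x
    rw [Set.inter_comm, hP.markov x T B hB U hU]
    have hm : Measurable fun y : E => P y U := measurable_of_finite _
    rw [← lintegral_map (μ := (P x).restrict B) hm (measurable_X T), lintegral_fintype]
    refine Finset.sum_congr rfl fun y _ => ?_
    rw [Measure.map_apply (measurable_X T) (measurableSet_singleton y), mul_comm,
      Measure.restrict_apply (measurable_X T (measurableSet_singleton y)), Set.inter_comm]
    rfl
  rw [Measure.map_apply (measurable_shift T) hU,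
    Measure.restrict_apply (measurable_shift T hU)]
  simp only [startedFrom, Measure.coe_finsetSum, Finset.sum_apply, Measure.smul_apply,
    smul_eq_mul, key, Finset.mul_sum, Finset.sum_mul]
  rw [Finset.sum_comm]
  simp only [mul_assoc]

lemma IsMarkovChain.real_inter_shift (hP : IsMarkovChain q P) (μ : PMF E) {T : ℝ≥0}
    {B : Set (CadlagPath E)} (hB : MeasurableSet[past T] B) {U : Set (CadlagPath E)}
    (hU : MeasurableSet U) :
    (startedFrom P μ).real (B ∩ shift T ⁻¹' U) =
      ∑ y, (startedFrom P μ).real (B ∩ {ω | X T ω = y}) * (P y).real U := by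
  have := hP.isProbabilityMeasure
  have := hP.isProbabilityMeasure_startedFrom μ
  have h := congrArg (fun ν => ν U) (hP.map_shift_restrict μ hB)
  simp only [Measure.coe_finsetSum, Finset.sum_apply, Measure.smul_apply, smul_eq_mul] at h
  rw [Measure.map_apply (measurable_shift T) hU,
    Measure.restrict_apply (measurable_shift T hU), Set.inter_comm] at h
  rw [Measure.real, h, ENNReal.toReal_sum fun x _ =>
    ENNReal.mul_ne_top (measure_ne_top _ _) (measure_ne_top _ _)]
  simp [Measure.real]

lemma IsMarkovChain.setLIntegral_shift (hP : IsMarkovChain q P) (μ : PMF E) {T : ℝ≥0}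
    {B : Set (CadlagPath E)} (hB : MeasurableSet[past T] B) {f : CadlagPath E → ℝ≥0∞}
    (hf : Measurable f) :
    ∫⁻ ω in B, f (shift T ω) ∂(startedFrom P μ) =
      ∑ y, startedFrom P μ (B ∩ {ω | X T ω = y}) * ∫⁻ ω, f ω ∂(P y) := by
  rw [← lintegral_map (μ := (startedFrom P μ).restrict B) hf (measurable_shift T),
    hP.map_shift_restrict μ hB]
  simp [lintegral_smul_measure]

lemma sum_real_inter_X (ν : Measure (CadlagPath E)) [IsFiniteMeasure ν]
    {B : Set (CadlagPath E)} (hB : MeasurableSet B) (T : ℝ≥0) :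
    ∑ y, ν.real (B ∩ {ω | X T ω = y}) = ν.real B := by
  rw [← measureReal_biUnion_finset]
  · congr 1
    ext ω
    simp
  · intro y _ z _ hyz
    refine Set.disjoint_left.2 fun ω h1 h2 => hyz ?_
    exact h1.2.symm.trans h2.2
  · exact fun y _ => hB.inter (measurableSet_X_eq T y)

lemma IsMarkovChain.real_inter_shift_le (hP : IsMarkovChain q P) (μ : PMF E) {T : ℝ≥0}
    {B : Set (CadlagPath E)} (hB : MeasurableSet[past T] B) {U : Set (CadlagPath E)}
    (hU : MeasurableSet U) {c : ℝ} (h : ∀ y, (P y).real U ≤ c) :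
    (startedFrom P μ).real (B ∩ shift T ⁻¹' U) ≤ (startedFrom P μ).real B * c := by
  have := hP.isProbabilityMeasure_startedFrom μ
  rw [hP.real_inter_shift μ hB hU, ← sum_real_inter_X _ (past_le T _ hB) T, Finset.sum_mul]
  exact Finset.sum_le_sum fun y _ => mul_le_mul_of_nonneg_left (h y) measureReal_nonneg

lemma IsMarkovChain.le_real_inter_shift (hP : IsMarkovChain q P) (μ : PMF E) {T : ℝ≥0}
    {B : Set (CadlagPath E)} (hB : MeasurableSet[past T] B) {U : Set (CadlagPath E)}
    (hU : MeasurableSet U) {c : ℝ} (h : ∀ y, c ≤ (P y).real U) :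
    (startedFrom P μ).real B * c ≤ (startedFrom P μ).real (B ∩ shift T ⁻¹' U) := by
  have := hP.isProbabilityMeasure_startedFrom μ
  rw [hP.real_inter_shift μ hB hU, ← sum_real_inter_X _ (past_le T _ hB) T, Finset.sum_mul]
  exact Finset.sum_le_sum fun y _ => mul_le_mul_of_nonneg_left (h y) measureReal_nonneg

/-- Iterating a uniform bound on the probability of avoiding `A` for a time `w`. -/
lemma IsMarkovChain.noHit_mul_le (hP : IsMarkovChain q P) {w : ℝ≥0} {ρ : ℝ}
    (h : ∀ y, (P y).real (noHit A w) ≤ ρ) (μ : PMF E) (k : ℕ) :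
    (startedFrom P μ).real (noHit A (k * w)) ≤ ρ ^ k := by
  have := hP.isProbabilityMeasure
  have := hP.isProbabilityMeasure_startedFrom μ
  obtain ⟨x, -⟩ := μ.support_nonempty
  have hρ : 0 ≤ ρ := measureReal_nonneg.trans (h x)
  induction k with
  | zero => simp
  | succ k ih =>
    have : ((k + 1 : ℕ) : ℝ≥0) * w = k * w + w := by push_cast; ring
    rw [this, noHit_add, pow_succ]
    refine (hP.real_inter_shift_le μ (measurableSet_past_noHit A _)
      (measurableSet_noHit A w) h).trans ?_
    gcongr

lemma hitProb_eq (hP : IsMarkovChain q P) (μ : PMF E) (A : Set E) (t : ℝ≥0) :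
    hitProb P μ A t = 1 - (startedFrom P μ).real (noHit A t) := by
  have := hP.isProbabilityMeasure_startedFrom μ
  rw [noHit, probReal_compl_eq_one_sub (past_le t _ (measurableSet_past_hit A t))]
  simp [hitProb]

lemma real_noHit_eq (hP : IsMarkovChain q P) (μ : PMF E) (A : Set E) (t : ℝ≥0) :
    (startedFrom P μ).real (noHit A t) = 1 - hitProb P μ A t := by
  rw [hitProb_eq hP]; ring

lemma MixedAt.abs_sum_sub_le (hP : IsMarkovChain q P) {a : ℝ} {T : ℝ≥0} (h : MixedAt P π a T)
    (x : E) {f : E → ℝ} (hf : ∀ x, f x ∈ Set.Icc (0 : ℝ) 1) :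
    |∑ y, (P x).real {ω | X T ω = y} * f y - ∑ y, (π y).toReal * f y| ≤ a := by
  have := hP.isProbabilityMeasure
  refine (abs_sum_mul_sub_le hf ?_ (pmf_sum_toReal π)).trans (le_of_eq_of_le ?_ (h x))
  · have := sum_real_inter_X (P x) MeasurableSet.univ T
    simpa using this
  · unfold tvDist
    congr 1
    refine Finset.sum_congr rfl fun y _ => ?_
    rw [map_measureReal_apply (measurable_X T) (measurableSet_singleton y)]
    congr 2
    simp [Measure.real, PMF.toMeasure_apply_singleton _ _ (measurableSet_singleton y)]

/-- After a mixing time, the law of the future is close to the stationary one. -/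
lemma MixedAt.abs_real_shift_sub_le (hP : IsMarkovChain q P) {a : ℝ} {T : ℝ≥0}
    (h : MixedAt P π a T) (x : E) {U : Set (CadlagPath E)} (hU : MeasurableSet U) :
    |(P x).real (shift T ⁻¹' U) - (startedFrom P π).real U| ≤ a := by
  have := hP.isProbabilityMeasure
  have h1 := hP.real_inter_shift (PMF.pure x) (T := T) (@MeasurableSet.univ _ (past T)) hU
  simp only [startedFrom_pure, Set.univ_inter] at h1
  rw [h1, hP.startedFrom_real]
  exact h.abs_sum_sub_le hP x fun y => ⟨measureReal_nonneg, measureReal_le_one⟩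

lemma tendsto_real_X_eq (ν : Measure (CadlagPath E)) [IsFiniteMeasure ν] (S : ℝ≥0) (y : E) :
    Tendsto (fun T => ν.real {ω | X T ω = y}) (𝓝[≥] S) (𝓝 (ν.real {ω | X S ω = y})) := by
  refine (ENNReal.tendsto_toReal (measure_ne_top _ _)).comp ?_
  refine tendsto_measure_of_ae_tendsto_indicator_of_isFiniteMeasure (𝓝[≥] S)
    (measurableSet_X_eq S y) (fun T => measurableSet_X_eq T y) (ae_of_all _ fun ω => ?_)
  obtain ⟨u, hu, hc⟩ := ω.exists_constant_right S
  filter_upwards [Ico_mem_nhdsGE hu] with T hT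
  simp [hc T hT.1 hT.2]

/-- The infimum defining the mixing time is attained. -/
lemma IsMixing.mixedAt_mixingTime (hP : IsMarkovChain q P) (hπ : IsMixing P π) {a : ℝ}
    (ha : a ∈ Set.Ioo (0 : ℝ) 1) : MixedAt P π a (mixingTime P π a) := by
  have := hP.isProbabilityMeasure
  set D : Set ℝ≥0 := {T : ℝ≥0 | MixedAt P π a T} with hD
  have hne : D.Nonempty := hπ.mixed a ha
  have hcl : sInf D ∈ closure D := csInf_mem_closure hne (OrderBot.bddBelow D)
  have : (𝓝[D] (sInf D)).NeBot := mem_closure_iff_nhdsWithin_neBot.1 hcl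
  intro x
  -- The infimum is approached from the right only, so right continuity of the law of X_T suffices.
  have hsub : D ⊆ Set.Ici (sInf D) := fun T hT => csInf_le (OrderBot.bddBelow D) hT
  have hlim : Tendsto (fun T => tvDist ((P x).map (X T)) π.toMeasure) (𝓝[D] (sInf D))
      (𝓝 (tvDist ((P x).map (X (sInf D))) π.toMeasure)) := by
    unfold tvDist
    refine Tendsto.const_mul _ (tendsto_finsetSum _ fun y _ => ?_)
    refine (Tendsto.sub_const ?_ _).abs
    simp only [map_measureReal_apply (measurable_X _) (measurableSet_singleton y)]
    exact (tendsto_real_X_eq (P x) (sInf D) y).mono_left (nhdsWithin_mono _ hsub)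
  refine le_of_tendsto hlim ?_
  filter_upwards [self_mem_nhdsWithin] with T hT using hT x

end Chains

/-! ### The stationary distribution function of the hitting time -/

/-- The next increment is at most the average of the earlier ones, hence at most f j / j; so f j / j
is nonincreasing. -/
lemma mul_le_mul_of_decreasing_increments {f : ℕ → ℝ} (h0 : 0 ≤ f 0)
    (hf : ∀ i j, i ≤ j → f (j + 1) - f j ≤ f (i + 1) - f i) {n j : ℕ} (hn : 1 ≤ n)
    (hnj : n ≤ j) : n * f j ≤ j * f n := by
  induction j, hnj using Nat.le_induction with
  | base => exact le_rfl
  | succ j hj ih =>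
    have hsum : (j : ℝ) * (f (j + 1) - f j) ≤ f j - f 0 := by
      have h := Finset.card_nsmul_le_sum (Finset.range j) (fun i => f (i + 1) - f i)
        (f (j + 1) - f j) fun i hi => hf i j (Finset.mem_range.1 hi).le
      rwa [Finset.card_range, nsmul_eq_mul, Finset.sum_range_sub] at h
    have hj0 : (0 : ℝ) < j := by exact_mod_cast hn.trans hj
    have hn0 : (0 : ℝ) ≤ n := Nat.cast_nonneg n
    push_cast
    refine le_of_mul_le_mul_left ?_ hj0
    have h1 : (j : ℝ) * f (j + 1) ≤ (j + 1) * f j := by linarith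
    calc (j : ℝ) * (n * f (j + 1)) = n * (j * f (j + 1)) := by ring
      _ ≤ n * ((j + 1) * f j) := by gcongr
      _ = (j + 1) * (n * f j) := by ring
      _ ≤ (j + 1) * (j * f n) := by gcongr
      _ = _ := by ring

lemma hitProb_nonneg {E : Type*} [Fintype E] [MeasurableSpace E]
    (P : E → Measure (CadlagPath E)) (μ : PMF E) (A : Set E) (t : ℝ≥0) :
    0 ≤ hitProb P μ A t := measureReal_nonneg

section StationaryHitting

variable {E : Type*} [Fintype E] [MeasurableSpace E] {q : E → E → ℝ}
  {P : E → Measure (CadlagPath E)} {π μ : PMF E} {A : Set E}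

lemma hitProb_mono (hP : IsMarkovChain q P) (μ : PMF E) (A : Set E) :
    Monotone (hitProb P μ A) := fun s t hst => by
  have := hP.isProbabilityMeasure_startedFrom μ
  exact measureReal_mono fun ω (hω : hittingTime A ω ≤ s) =>
    show hittingTime A ω ≤ t from hω.trans (by exact_mod_cast hst)

variable [MeasurableSingletonClass E]

/-- A first hit in (s+t, s+t+h] is, for the path shifted by s, a first hit in (t, t+h]. The shift
drops the constraint on [0, s) and preserves the stationary law. -/
lemma IsStationaryLaw.hitProb_increment_le (hP : IsMarkovChain q P) (hπ : IsStationaryLaw P π)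
    (A : Set E) (s t h : ℝ≥0) :
    hitProb P π A (s + t + h) - hitProb P π A (s + t) ≤
      hitProb P π A (t + h) - hitProb P π A t := by
  have := hP.isProbabilityMeasure_startedFrom π
  have key : ∀ r, hitProb P π A (r + h) - hitProb P π A r =
      (startedFrom P π).real (noHit A r \ noHit A (r + h)) := fun r => by
    rw [measureReal_sdiff (noHit_anti A (by simp)) (measurableSet_noHit A _), hitProb_eq hP,
      hitProb_eq hP]
    ring
  rw [key, key, ← hπ.real_preimage_shift s
    ((measurableSet_noHit A t).diff (measurableSet_noHit A (t + h)))]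
  refine measureReal_mono ?_
  rintro ω ⟨h1, h2⟩
  rw [add_assoc, noHit_add] at h2
  rw [noHit_add] at h1
  exact ⟨h1.2, fun h3 => h2 ⟨h1.1, h3⟩⟩

lemma tendsto_hitProb_nhdsGE (hP : IsMarkovChain q P) (μ : PMF E) (A : Set E) (s : ℝ≥0) :
    Tendsto (hitProb P μ A) (𝓝[≥] s) (𝓝 (hitProb P μ A s)) := by
  have := hP.isProbabilityMeasure_startedFrom μ
  refine (ENNReal.tendsto_toReal (measure_ne_top _ _)).comp ?_
  refine tendsto_measure_of_ae_tendsto_indicator_of_isFiniteMeasure (𝓝[≥] s)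
    (past_le s _ (measurableSet_past_hit A s))
    (fun t => past_le t _ (measurableSet_past_hit A t)) (ae_of_all _ fun ω => ?_)
  by_cases h : hittingTime A ω ≤ s
  · filter_upwards [self_mem_nhdsWithin] with t ht
    have : hittingTime A ω ≤ t := h.trans (by exact_mod_cast ht)
    simp [h, this]
  · have : ∀ᶠ t : ℝ≥0 in 𝓝 s, (t : ℝ≥0∞) < hittingTime A ω :=
      (ENNReal.continuous_coe.tendsto s).eventually_lt_const (not_le.1 h)
    filter_upwards [nhdsWithin_le_nhds this] with t ht
    simp [h, ht]

/-- The increment over [0, h] bounds every increment of length h, so right continuity at 0 yields a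
modulus of continuity. The value at 0 itself need not vanish. -/
lemma IsStationaryLaw.continuous_hitProb (hP : IsMarkovChain q P) (hπ : IsStationaryLaw P π)
    (A : Set E) : Continuous (hitProb P π A) := by
  have hmod : ∀ x y, x ≤ y → |hitProb P π A y - hitProb P π A x| ≤
      hitProb P π A (y - x) - hitProb P π A 0 := fun x y hxy => by
    rw [abs_of_nonneg (sub_nonneg.2 (hitProb_mono hP π A hxy))]
    have := hπ.hitProb_increment_le hP A x 0 (y - x)
    simpa [add_tsub_cancel_of_le hxy] using this
  refine continuous_iff_continuousAt.2 fun x => ?_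
  refine tendsto_iff_dist_tendsto_zero.2 ?_
  have hlim : Tendsto (fun y : ℝ≥0 => hitProb P π A (nndist y x) - hitProb P π A 0) (𝓝 x)
      (𝓝 0) := by
    have h0 : Tendsto (hitProb P π A) (𝓝 0) (𝓝 (hitProb P π A 0)) := by
      have := tendsto_hitProb_nhdsGE hP π A 0
      rwa [show Set.Ici (0 : ℝ≥0) = Set.univ by ext; simp, nhdsWithin_univ] at this
    have h1 : Tendsto (fun y : ℝ≥0 => nndist y x) (𝓝 x) (𝓝 0) := by
      have : Continuous fun y : ℝ≥0 => nndist y x := by fun_prop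
      simpa using this.tendsto x
    simpa using (h0.comp h1).sub_const (hitProb P π A 0)
  refine squeeze_zero (fun _ => dist_nonneg) (fun y => ?_) hlim
  rw [Real.dist_eq]
  rcases le_total x y with h | h
  · have : nndist y x = y - x := by
      ext; rw [coe_nndist, NNReal.dist_eq, NNReal.coe_sub h, abs_of_nonneg (by simpa using h)]
    rw [this]
    exact hmod x y h
  · have : nndist y x = x - y := by
      ext; rw [coe_nndist, NNReal.dist_eq, NNReal.coe_sub h, abs_of_nonpos (by simpa using h)]
      ring
    rw [this, abs_sub_comm]
    exact hmod y x h

/-- `t ↦ P_π(H_A ≤ t) / t` is nonincreasing. -/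
lemma IsStationaryLaw.mul_hitProb_le (hP : IsMarkovChain q P) (hπ : IsStationaryLaw P π)
    (A : Set E) {s t : ℝ≥0} (hst : s ≤ t) :
    (s : ℝ) * hitProb P π A t ≤ t * hitProb P π A s := by
  rcases eq_or_ne s 0 with rfl | hs
  · simpa using mul_nonneg t.2 (hitProb_nonneg P π A 0)
  have hs0 : (0 : ℝ) < s := by exact_mod_cast pos_iff_ne_zero.2 hs
  have key : ∀ n : ℕ, (s : ℝ) * hitProb P π A t ≤
      (t + s * (1 / ((n : ℝ) + 1))) * hitProb P π A s := fun n => by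
    -- A grid on which s is exactly n + 1 steps, while t is rounded up to j steps. The rounding
    -- costs at most h, which vanishes as n grows.
    set h : ℝ≥0 := s / (n + 1) with hh
    have hnh : ((n + 1 : ℕ) : ℝ≥0) * h = s := by
      rw [hh]; push_cast; field_simp
    have hh0 : 0 < h := by positivity
    set j := ⌈t / h⌉₊ with hj
    have htj : t ≤ j * h := (div_le_iff₀ hh0).1 (Nat.le_ceil _)
    have hjt : (j : ℝ≥0) < t / h + 1 := Nat.ceil_lt_add_one (by positivity)
    have hnj : n + 1 ≤ j := by
      have : ((n + 1 : ℕ) : ℝ≥0) ≤ j := by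
        refine le_of_mul_le_mul_right ?_ hh0
        rw [hnh]; exact hst.trans htj
      exact_mod_cast this
    have hinc := mul_le_mul_of_decreasing_increments
      (f := fun i : ℕ => hitProb P π A (i * h)) (hitProb_nonneg P π A _)
      (fun i k hik => by
        have := hπ.hitProb_increment_le hP A ((k - i : ℕ) * h) (i * h) h
        have e1 : ((k - i : ℕ) : ℝ≥0) * h + i * h = k * h := by
          rw [← add_mul, ← Nat.cast_add, Nat.sub_add_cancel hik]
        rw [e1] at this
        simpa [add_mul] using this) (Nat.le_add_left 1 n) hnj
    simp only [hnh] at hinc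
    have hmono := hitProb_mono hP π A htj
    have hF := hitProb_nonneg P π A s
    have hhs : (h : ℝ) = s / (n + 1) := by rw [hh]; push_cast; rfl
    have hn1 : (0 : ℝ) < (n : ℝ) + 1 := by positivity
    have hjt' : (j : ℝ) * h ≤ t + h := by
      have h1 : (j : ℝ) < t / h + 1 := by exact_mod_cast hjt
      have h2 : (0 : ℝ) < h := by exact_mod_cast hh0
      have h3 := mul_le_mul_of_nonneg_right h1.le h2.le
      rwa [add_mul, one_mul, div_mul_cancel₀ _ h2.ne'] at h3
    have hsn : (s : ℝ) = h * ((n : ℝ) + 1) := by rw [hhs]; field_simp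
    push_cast at hinc
    calc (s : ℝ) * hitProb P π A t ≤ s * hitProb P π A (j * h) := by gcongr
      _ = h * (((n : ℝ) + 1) * hitProb P π A (j * h)) := by rw [hsn]; ring
      _ ≤ h * (j * hitProb P π A s) := by gcongr
      _ = (j * h) * hitProb P π A s := by ring
      _ ≤ (t + h) * hitProb P π A s := by gcongr
      _ = _ := by rw [hhs]; ring
  have hlim : Tendsto (fun n : ℕ => ((t : ℝ) + s * (1 / ((n : ℝ) + 1))) * hitProb P π A s) atTop
      (𝓝 ((t + s * 0) * hitProb P π A s)) :=
    ((tendsto_one_div_add_atTop_nhds_zero_nat.const_mul (s : ℝ)).const_add (t : ℝ)).mul_const _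
  simpa using ge_of_tendsto' hlim key

/-- A mixing chain hits `A` eventually. -/
lemma IsMixing.exists_lt_hitProb (hP : IsMarkovChain q P) (hπ : IsMixing P π)
    (hA : 0 < π.toMeasure A) {c : ℝ} (hc : c < 1) : ∃ t, c < hitProb P π A t := by
  have := hP.isProbabilityMeasure
  have hAr : 0 < π.toMeasure.real A := ENNReal.toReal_pos hA.ne' (measure_ne_top _ _)
  have hA1 : π.toMeasure.real A ≤ 1 := measureReal_le_one
  obtain ⟨T, hT⟩ := hπ.mixed (π.toMeasure.real A / 2) ⟨by linarith, by linarith⟩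
  classical
  -- At time T the chain is in A with probability at least π(A) - π(A)/2 from every state.
  have key : ∀ y, (P y).real (noHit A T) ≤ 1 - π.toMeasure.real A / 2 := by
    intro y
    have h := hT.abs_sum_sub_le hP y (f := fun x => if x ∈ A then 0 else 1)
      (fun x => by by_cases h : x ∈ A <;> simp [h])
    have h1 : (P y).real (noHit A T) ≤
        ∑ z, (P y).real {ω | X T ω = z} * (if z ∈ A then 0 else 1) := by
      rw [← sum_real_inter_X (P y) (measurableSet_noHit A T) T]
      refine Finset.sum_le_sum fun z _ => ?_
      by_cases hz : z ∈ A
      · have : noHit A T ∩ {ω | X T ω = z} = ∅ := by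
          ext ω
          simp only [Set.mem_inter_iff, Set.mem_ofPred_eq, Set.mem_empty_iff_false, iff_false,
            not_and]
          exact fun h1 h2 => mem_noHit.1 h1 T le_rfl (h2 ▸ hz)
        simp [this, hz]
      · simpa [hz] using measureReal_mono Set.inter_subset_right
    have h2 : ∑ z, (π z).toReal * (if z ∈ A then 0 else 1) = 1 - π.toMeasure.real A := by
      have h3 : π.toMeasure.real A = ∑ z, (π z).toReal * (if z ∈ A then 1 else 0) := by
        rw [Measure.real, PMF.toMeasure_apply_fintype,
          ENNReal.toReal_sum]
        · refine Finset.sum_congr rfl fun z _ => ?_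
          by_cases hz : z ∈ A <;> simp [hz]
        · intro z _
          by_cases hz : z ∈ A <;> simp [hz, π.apply_ne_top]
      rw [h3, eq_sub_iff_add_eq, ← Finset.sum_add_distrib]
      refine (Finset.sum_congr rfl fun z _ => ?_).trans (pmf_sum_toReal π)
      by_cases hz : z ∈ A <;> simp [hz]
    rw [h2] at h
    linarith [(abs_le.1 h).2]
  obtain ⟨k, hk⟩ := exists_pow_lt_of_lt_one (sub_pos.2 hc)
    (show 1 - π.toMeasure.real A / 2 < 1 by linarith)
  refine ⟨k * T, ?_⟩
  rw [hitProb_eq hP]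
  linarith [hP.noHit_mul_le key π k]

lemma IsMixing.existsUnique_hitProb_eq (hP : IsMarkovChain q P) (hπ : IsMixing P π)
    (hA : 0 < π.toMeasure A) {ε : ℝ} (h0 : hitProb P π A 0 ≤ ε) (h1 : ε < 1) :
    ∃! t, hitProb P π A t = ε := by
  obtain ⟨T, hT⟩ := hπ.exists_lt_hitProb hP hA h1
  obtain ⟨t, -, ht⟩ := intermediate_value_Icc (zero_le (a := T))
    (hπ.stationary.continuous_hitProb hP A).continuousOn ⟨h0, hT.le⟩
  -- One flat stretch forces all later increments of that length to vanish, keeping F at ε forever,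
  -- although F exceeds ε at T.
  have aux : ∀ s t, s < t → hitProb P π A s = ε → hitProb P π A t = ε → False := by
    intro s t hst hs ht
    obtain ⟨d, rfl⟩ := exists_add_of_le hst.le
    have hd : 0 < d := by simpa using hst
    have hk : ∀ k : ℕ, hitProb P π A (s + k * d) ≤ ε := by
      intro k
      induction k with
      | zero => simp [hs]
      | succ k ih =>
        have := hπ.stationary.hitProb_increment_le hP A (k * d) s d
        rw [hs, ht, add_comm _ s, add_assoc] at this
        have e : ((k + 1 : ℕ) : ℝ≥0) * d = k * d + d := by push_cast; ring
        rw [e]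
        linarith
    obtain ⟨k, hk'⟩ := exists_nat_ge (T / d)
    have : T ≤ s + k * d := ((div_le_iff₀ hd).1 hk').trans (by simp)
    linarith [hitProb_mono hP π A this, hk k]
  refine ⟨t, ht, fun s hs => ?_⟩
  rcases lt_trichotomy s t with h | h | h
  · exact (aux s t h hs ht).elim
  · exact h
  · exact (aux t s h ht hs).elim

end StationaryHitting

/-! ### Mean hitting times -/

/-- Truncating at multiples of w lets the renewal inequality for the mean be run as an induction on
n, with no prior knowledge that the mean is finite. -/
lemma hittingTime_min_le {E : Type*} (A : Set E) (w : ℝ≥0) (n : ℕ) (ω : CadlagPath E) :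
    min (hittingTime A ω) ((n + 1 : ℕ) * w) ≤
      w + (noHit A w).indicator (fun ω => min (hittingTime A (shift w ω)) (n * w)) ω := by
  by_cases h : ω ∈ noHit A w
  · rw [Set.indicator_of_mem h, ← min_add_add_left]
    refine min_le_min (hittingTime_le_add_shift A w ω) (le_of_eq ?_)
    push_cast; ring
  · rw [Set.indicator_of_notMem h, add_zero]
    rw [mem_noHit_iff_lt, not_lt] at h
    exact (min_le_left _ _).trans h

section MeanHitting

variable {E : Type*} [Fintype E] [MeasurableSpace E] {q : E → E → ℝ}
  {P : E → Measure (CadlagPath E)} {π μ : PMF E} {A : Set E}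

lemma meanHit_toReal (P : E → Measure (CadlagPath E)) (μ : PMF E)
    (h : ∀ y, ∫⁻ ω, hittingTime A ω ∂(P y) ≠ ∞) :
    (meanHit P μ A).toReal = ∑ y, (μ y).toReal * (∫⁻ ω, hittingTime A ω ∂(P y)).toReal := by
  rw [meanHit, lintegral_startedFrom, ENNReal.toReal_sum fun y _ =>
    ENNReal.mul_ne_top (μ.apply_ne_top y) (h y)]
  simp

lemma meanHit_ne_top (P : E → Measure (CadlagPath E)) (μ : PMF E)
    (h : ∀ y, ∫⁻ ω, hittingTime A ω ∂(P y) ≠ ∞) : meanHit P μ A ≠ ∞ := by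
  rw [meanHit, lintegral_startedFrom]
  exact ENNReal.sum_ne_top.2 fun y _ => ENNReal.mul_ne_top (μ.apply_ne_top y) (h y)

lemma meanHit_le (P : E → Measure (CadlagPath E)) (μ : PMF E) {c : ℝ≥0∞}
    (h : ∀ y, ∫⁻ ω, hittingTime A ω ∂(P y) ≤ c) : meanHit P μ A ≤ c := by
  rw [meanHit, lintegral_startedFrom]
  calc _ ≤ ∑ x, μ x * c := Finset.sum_le_sum fun y _ => by gcongr; exact h y
    _ = c := by
      rw [← Finset.sum_mul, ← tsum_fintype (L := .unconditional _), μ.tsum_coe, one_mul]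

variable [MeasurableSingletonClass E]

lemma IsMarkovChain.setLIntegral_shift_le (hP : IsMarkovChain q P) (μ : PMF E) {T : ℝ≥0}
    {B : Set (CadlagPath E)} (hB : MeasurableSet[past T] B) {f : CadlagPath E → ℝ≥0∞}
    (hf : Measurable f) {c : ℝ≥0∞} (h : ∀ y, ∫⁻ ω, f ω ∂(P y) ≤ c) :
    ∫⁻ ω in B, f (shift T ω) ∂(startedFrom P μ) ≤ startedFrom P μ B * c := by
  have hsum : ∑ y, startedFrom P μ (B ∩ {ω | X T ω = y}) = startedFrom P μ B := by
    rw [← measure_biUnion_finset]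
    · congr 1
      ext ω
      simp
    · intro y _ z _ hyz
      exact Set.disjoint_left.2 fun ω h1 h2 => hyz (h1.2.symm.trans h2.2)
    · exact fun y _ => (past_le T _ hB).inter (measurableSet_X_eq T y)
  rw [hP.setLIntegral_shift μ hB hf, ← hsum, Finset.sum_mul]
  exact Finset.sum_le_sum fun y _ => by gcongr; exact h y

/-- If `A` is hit within time `w` with probability at least `p` from every state, then the mean
hitting time is at most `w / p`. -/
lemma IsMarkovChain.lintegral_hittingTime_le (hP : IsMarkovChain q P) {w : ℝ≥0} (hw : 0 < w)
    {p : ℝ} (hp : 0 < p) (h : ∀ y, (P y).real (noHit A w) ≤ 1 - p) (y : E) :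
    ∫⁻ ω, hittingTime A ω ∂(P y) ≤ ENNReal.ofReal (w / p) := by
  have := hP.isProbabilityMeasure
  have hp1 : 0 ≤ 1 - p := measureReal_nonneg.trans (h y)
  have hmin : ∀ n : ℕ, Measurable fun ω : CadlagPath E => min (hittingTime A ω) (n * w) :=
    fun n => (measurable_hittingTime A).min measurable_const
  have key : ∀ n : ℕ, ∀ y, ∫⁻ ω, min (hittingTime A ω) (n * w) ∂(P y) ≤
      ENNReal.ofReal (w / p) := by
    intro n
    induction n with
    | zero => simp
    | succ n ih =>
      intro y
      calc ∫⁻ ω, min (hittingTime A ω) ((n + 1 : ℕ) * w) ∂(P y)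
          ≤ ∫⁻ ω, w + (noHit A w).indicator
              (fun ω => min (hittingTime A (shift w ω)) (n * w)) ω ∂(P y) :=
            lintegral_mono fun ω => hittingTime_min_le A w n ω
        _ = w + ∫⁻ ω in noHit A w, min (hittingTime A (shift w ω)) (n * w) ∂(P y) := by
            rw [lintegral_add_left measurable_const, lintegral_const, measure_univ, mul_one,
              lintegral_indicator (measurableSet_noHit A w)]
        _ ≤ w + P y (noHit A w) * ENNReal.ofReal (w / p) := by
            have := hP.setLIntegral_shift_le (PMF.pure y) (measurableSet_past_noHit A w)
              (hmin n) ih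
            rw [startedFrom_pure] at this
            gcongr
        _ ≤ ENNReal.ofReal w + ENNReal.ofReal (1 - p) * ENNReal.ofReal (w / p) := by
            gcongr
            · simp
            · rw [← ofReal_measureReal]
              exact ENNReal.ofReal_le_ofReal (h y)
        -- The bound w / p is the fixed point of c ↦ w + (1 - p) c.
        _ = ENNReal.ofReal (w / p) := by
            rw [← ENNReal.ofReal_mul hp1, ← ENNReal.ofReal_add w.coe_nonneg (by positivity)]
            congr 1
            field_simp
            ring
  have hsup : ∀ ω : CadlagPath E, hittingTime A ω = ⨆ n : ℕ, min (hittingTime A ω) (n * w) := by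
    intro ω
    have : (⨆ n : ℕ, (n : ℝ≥0∞) * w) = ⊤ := by
      rw [← ENNReal.iSup_mul, ENNReal.iSup_natCast, ENNReal.top_mul (by simpa using hw.ne')]
    have h1 := inf_iSup_eq (hittingTime A ω) fun n : ℕ => (n : ℝ≥0∞) * w
    rw [this, inf_top_eq] at h1
    exact h1
  rw [lintegral_congr hsup, lintegral_iSup hmin]
  · exact iSup_le fun n => key n y
  · intro m n hmn ω
    exact min_le_min le_rfl (by gcongr)

lemma IsMarkovChain.setLIntegral_shift_toReal (hP : IsMarkovChain q P) (μ : PMF E) {T : ℝ≥0}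
    {B : Set (CadlagPath E)} (hB : MeasurableSet[past T] B) {f : CadlagPath E → ℝ≥0∞}
    (hf : Measurable f) (h : ∀ y, ∫⁻ ω, f ω ∂(P y) ≠ ∞) :
    (∫⁻ ω in B, f (shift T ω) ∂(startedFrom P μ)).toReal =
      ∑ y, (startedFrom P μ).real (B ∩ {ω | X T ω = y}) * (∫⁻ ω, f ω ∂(P y)).toReal := by
  have := hP.isProbabilityMeasure_startedFrom μ
  rw [hP.setLIntegral_shift μ hB hf, ENNReal.toReal_sum fun y _ =>
    ENNReal.mul_ne_top (measure_ne_top _ _) (h y)]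
  simp [Measure.real]

/-- The largest mean hitting time exceeds the stationary one by little more than the mixing
time. -/
lemma MixedAt.mul_mean_le (hP : IsMarkovChain q P) {a : ℝ} {S : ℝ≥0} (hS : MixedAt P π a S)
    (h : ∀ y, ∫⁻ ω, hittingTime A ω ∂(P y) ≠ ∞) {K : ℝ}
    (hK : ∀ y, (∫⁻ ω, hittingTime A ω ∂(P y)).toReal ≤ K) (x : E)
    (hx : (∫⁻ ω, hittingTime A ω ∂(P x)).toReal = K) :
    (1 - a) * K ≤ S + (meanHit P π A).toReal := by
  have := hP.isProbabilityMeasure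
  set e : E → ℝ := fun y => (∫⁻ ω, hittingTime A ω ∂(P y)).toReal with he
  have he0 : ∀ y, 0 ≤ e y := fun y => ENNReal.toReal_nonneg
  have hK0 : 0 ≤ K := (he0 x).trans (hK x)
  rcases hK0.eq_or_lt with hK0 | hK0
  · rw [← hK0, mul_zero]
    positivity
  have h1 : K ≤ S + ∑ y, (P x).real {ω | X S ω = y} * e y := by
    have h2 := hP.setLIntegral_shift_toReal (PMF.pure x) (T := S)
      (@MeasurableSet.univ _ (past S)) (measurable_hittingTime A) h
    simp only [startedFrom_pure, Set.univ_inter, Measure.restrict_univ] at h2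
    have h3 : ∫⁻ ω, hittingTime A (shift S ω) ∂(P x) ≠ ∞ := by
      have h4 := hP.setLIntegral_shift (PMF.pure x) (T := S)
        (@MeasurableSet.univ _ (past S)) (measurable_hittingTime A)
      simp only [startedFrom_pure, Set.univ_inter, Measure.restrict_univ] at h4
      rw [h4]
      exact ENNReal.sum_ne_top.2 fun y _ => ENNReal.mul_ne_top (measure_ne_top _ _) (h y)
    rw [← h2, ← hx]
    have h5 : ∫⁻ ω, hittingTime A ω ∂(P x) ≤ S + ∫⁻ ω, hittingTime A (shift S ω) ∂(P x) := by
      refine (lintegral_mono fun ω => hittingTime_le_add_shift A S ω).trans (le_of_eq ?_)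
      rw [lintegral_add_left measurable_const, lintegral_const, measure_univ, mul_one]
    refine (ENNReal.toReal_mono (ENNReal.add_ne_top.2 ⟨ENNReal.coe_ne_top, h3⟩) h5).trans ?_
    rw [ENNReal.toReal_add ENNReal.coe_ne_top h3]
    rfl
  -- Division by the maximum K puts the means in [0, 1], where total variation distance applies.
  have h2 := (abs_le.1 (hS.abs_sum_sub_le hP x (f := fun y => e y / K)
    fun y => ⟨div_nonneg (he0 y) hK0.le, (div_le_one hK0).2 (hK y)⟩)).2
  simp only [← mul_div_assoc, ← Finset.sum_div] at h2
  rw [← meanHit_toReal P π h, ← sub_div, div_le_iff₀ hK0] at h2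
  linarith

/-- A lower bound for the largest mean hitting time. -/
lemma IsStationaryLaw.le_mul_mean (hP : IsMarkovChain q P) (hπ : IsStationaryLaw P π)
    (h : ∀ y, ∫⁻ ω, hittingTime A ω ∂(P y) ≠ ∞) {K : ℝ}
    (hK : ∀ y, (∫⁻ ω, hittingTime A ω ∂(P y)).toReal ≤ K) (t : ℝ≥0) :
    t * (1 - hitProb P π A t) ≤ hitProb P π A t * K := by
  have := hP.isProbabilityMeasure_startedFrom π
  set e : E → ℝ := fun y => (∫⁻ ω, hittingTime A ω ∂(P y)).toReal with he
  have hfin := meanHit_ne_top P π h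
  have hB := measurableSet_past_noHit A t
  have h1 : (meanHit P π A).toReal =
      (∫⁻ ω, hittingTime A (shift t ω) ∂(startedFrom P π)).toReal := by
    rw [meanHit, ← hπ t, lintegral_map (measurable_hittingTime A) (measurable_shift t), hπ t]
  have hunion : ∫⁻ ω, hittingTime A (shift t ω) ∂(startedFrom P π) =
      ∫⁻ ω in noHit A t, hittingTime A (shift t ω) ∂(startedFrom P π) +
      ∫⁻ ω in (noHit A t)ᶜ, hittingTime A (shift t ω) ∂(startedFrom P π) :=
    (lintegral_add_compl _ (measurableSet_noHit A t)).symm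
  have hne : ∀ B, MeasurableSet[past t] B →
      ∫⁻ ω in B, hittingTime A (shift t ω) ∂(startedFrom P π) ≠ ∞ := fun B hB => by
    rw [hP.setLIntegral_shift π hB (measurable_hittingTime A)]
    exact ENNReal.sum_ne_top.2 fun y _ => ENNReal.mul_ne_top (measure_ne_top _ _) (h y)
  -- By stationarity H_A and H_A ∘ Θ_t have the same mean. Their contributions from paths avoiding A
  -- up to t then cancel, leaving t P_π(H_A > t) against the mean of H_A ∘ Θ_t on the paths that hit
  -- by t.
  have hlow : t * startedFrom P π (noHit A t) +
      ∫⁻ ω in noHit A t, hittingTime A (shift t ω) ∂(startedFrom P π) ≤ meanHit P π A := by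
    rw [← setLIntegral_const, ← lintegral_add_left measurable_const]
    refine (setLIntegral_mono (measurable_hittingTime A) fun ω hω => ?_).trans
      (setLIntegral_le_lintegral _ _)
    exact add_hittingTime_shift_le hω
  have hlow' := ENNReal.toReal_mono hfin hlow
  rw [ENNReal.toReal_add (ENNReal.mul_ne_top ENNReal.coe_ne_top (measure_ne_top _ _))
    (hne _ hB), ENNReal.toReal_mul, h1, hunion, ENNReal.toReal_add (hne _ hB)
    (hne _ hB.compl)] at hlow'
  have hup : (∫⁻ ω in (noHit A t)ᶜ, hittingTime A (shift t ω) ∂(startedFrom P π)).toReal ≤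
      hitProb P π A t * K := by
    have h2 : hitProb P π A t = (startedFrom P π).real (noHit A t)ᶜ := by
      simp [hitProb, noHit]
    rw [hP.setLIntegral_shift_toReal π hB.compl (measurable_hittingTime A) h, h2,
      ← sum_real_inter_X _ (measurableSet_noHit A t).compl t, Finset.sum_mul]
    exact Finset.sum_le_sum fun y _ => mul_le_mul_of_nonneg_left (hK y) measureReal_nonneg
  rw [← real_noHit_eq hP]
  have h3 : ((t : ℝ≥0∞).toReal) = t := rfl
  rw [h3, ← Measure.real] at hlow'
  linarith

end MeanHitting

/-! ### Block estimates for the tail -/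

lemma CadlagPath.shift_shift {E : Type*} (S T : ℝ≥0) (ω : CadlagPath E) :
    shift T (shift S ω) = shift (S + T) ω := by
  simp only [shift, CadlagPath.mk.injEq]
  funext s
  rw [add_assoc, add_comm T S]

section Tails

variable {E : Type*} [Fintype E] [MeasurableSpace E] [MeasurableSingletonClass E]
  {q : E → E → ℝ} {P : E → Measure (CadlagPath E)} {π μ : PMF E} {A : Set E}

lemma MixedAt.noHit_add_le (hP : IsMarkovChain q P) {a : ℝ} {S : ℝ≥0} (hS : MixedAt P π a S)
    (A : Set E) (t : ℝ≥0) (y : E) :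
    (P y).real (noHit A (S + t)) ≤ 1 - hitProb P π A t + a := by
  have := hP.isProbabilityMeasure
  have h := (abs_le.1 (hS.abs_real_shift_sub_le hP y (measurableSet_noHit A t))).2
  rw [real_noHit_eq hP] at h
  have : (P y).real (noHit A (S + t)) ≤ (P y).real (shift S ⁻¹' noHit A t) := by
    rw [noHit_add]; exact measureReal_mono Set.inter_subset_right
  linarith

lemma MixedAt.le_shift_noHit (hP : IsMarkovChain q P) {a : ℝ} {S : ℝ≥0} (hS : MixedAt P π a S)
    (A : Set E) (t : ℝ≥0) (y : E) :
    1 - hitProb P π A t - a ≤ (P y).real (shift S ⁻¹' noHit A (t - S)) := by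
  have h := (abs_le.1 (hS.abs_real_shift_sub_le hP y (measurableSet_noHit A (t - S)))).1
  rw [real_noHit_eq hP] at h
  linarith [hitProb_mono hP π A (tsub_le_self : t - S ≤ t)]

/-- Controls a hit in the window [t, t+S] from any state: the chain has mixed by time S ≤ t, and
stationarity absorbs the remaining t - S. -/
lemma MixedAt.shift_hit_le (hP : IsMarkovChain q P) (hπ : IsStationaryLaw P π) {a : ℝ} {S : ℝ≥0}
    (hS : MixedAt P π a S) (A : Set E) {t : ℝ≥0} (hSt : S ≤ t) (y : E) :
    (P y).real (shift t ⁻¹' (noHit A S)ᶜ) ≤ hitProb P π A S + a := by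
  have hm := (measurableSet_noHit A S).compl
  have h := (abs_le.1 (hS.abs_real_shift_sub_le hP y (measurable_shift (t - S) hm))).2
  rw [hπ.real_preimage_shift (t - S) hm, ← Set.preimage_comp] at h
  have e : (shift (t - S) ∘ shift S : CadlagPath E → CadlagPath E) = shift t := by
    funext ω
    rw [Function.comp_apply, shift_shift, add_tsub_cancel_of_le hSt]
  have e2 : (startedFrom P π).real (noHit A S)ᶜ = hitProb P π A S := by simp [noHit, hitProb]
  rw [e, e2] at h
  linarith

/-- Avoiding `A` for one block of length `t`. -/
lemma MixedAt.le_noHit (hP : IsMarkovChain q P) {a : ℝ} {S : ℝ≥0} (hS : MixedAt P π a S)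
    {t : ℝ≥0} (hSt : S ≤ t) (μ : PMF E) :
    1 - hitProb P π A t - a - hitProb P μ A S ≤ (startedFrom P μ).real (noHit A t) := by
  have := hP.isProbabilityMeasure_startedFrom μ
  have h1 := hP.le_startedFrom_real μ (hS.le_shift_noHit hP A t)
  have h2 : (startedFrom P μ).real (shift S ⁻¹' noHit A (t - S)) ≤
      (startedFrom P μ).real (noHit A t ∪ (noHit A S)ᶜ) := by
    refine measureReal_mono fun ω hω => ?_
    by_cases h : ω ∈ noHit A S
    · left
      have e := noHit_add A S (t - S)
      rw [add_tsub_cancel_of_le hSt] at e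
      rw [e]
      exact ⟨h, hω⟩
    · exact Or.inr h
  have e2 : (startedFrom P μ).real (noHit A S)ᶜ = hitProb P μ A S := by simp [noHit, hitProb]
  linarith [measureReal_union_le (μ := startedFrom P μ) (noHit A t) (noHit A S)ᶜ]

/-- Avoiding `A` for one more block of length `t`. -/
lemma MixedAt.noHit_recursion (hP : IsMarkovChain q P) (hπ : IsStationaryLaw P π) {a : ℝ}
    {S : ℝ≥0} (hS : MixedAt P π a S) {t : ℝ≥0} (hSt : S ≤ t) (μ : PMF E) (k : ℕ) :
    (startedFrom P μ).real (noHit A ((k + 1 : ℕ) * t)) * (1 - hitProb P π A t - a) -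
      (startedFrom P μ).real (noHit A (k * t)) * (hitProb P π A S + a) ≤
      (startedFrom P μ).real (noHit A ((k + 2 : ℕ) * t)) := by
  have := hP.isProbabilityMeasure_startedFrom μ
  have e1 : ((k + 2 : ℕ) : ℝ≥0) * t = (k + 1 : ℕ) * t + t := by push_cast; ring
  have e0 : (k : ℝ≥0) * t + t = (k + 1 : ℕ) * t := by push_cast; ring
  set T : ℝ≥0 := (k + 1 : ℕ) * t with hT
  have h1 := hP.le_real_inter_shift μ (measurableSet_past_noHit A T)
    (measurable_shift S (measurableSet_noHit A (t - S))) (hS.le_shift_noHit hP A t)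
  have h2 := hP.real_inter_shift_le μ (measurableSet_past_noHit A (k * t))
    (measurable_shift t (measurableSet_noHit A S).compl) (hS.shift_hit_le hP hπ A hSt)
  -- The hit falls just after (k+1)t, but avoidance is required only up to kt, which leaves a full
  -- block for mixing.
  set D := noHit A (k * t) ∩ shift (k * t) ⁻¹' (shift t ⁻¹' (noHit A S)ᶜ) with hD
  have h3 : (startedFrom P μ).real (noHit A T ∩ shift T ⁻¹' (shift S ⁻¹' noHit A (t - S))) ≤
      (startedFrom P μ).real (noHit A (T + t) ∪ D) := by
    refine measureReal_mono fun ω hω => ?_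
    by_cases h : shift T ω ∈ noHit A S
    · left
      have e := noHit_add A S (t - S)
      rw [add_tsub_cancel_of_le hSt] at e
      rw [noHit_add, e]
      exact ⟨hω.1, h, hω.2⟩
    · right
      refine ⟨noHit_anti A (by rw [← e0]; simp) hω.1, ?_⟩
      simp only [Set.mem_preimage, shift_shift, e0]
      exact h
  rw [e1]
  linarith [measureReal_union_le (μ := startedFrom P μ) (noHit A (T + t)) D]

end Tails

/-! ### Numerical inequalities -/

section Numerics

/-- The induction carries v k ≤ 2 v (k+1), so the subtracted term is at most 4δε v (k+1), whence 5 =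
1 + 4. The resulting ratio exceeds 1/2 and so restores the carried inequality. -/
lemma geometric_lower_bound {v : ℕ → ℝ} {ε δ : ℝ} (hε : 0 < ε) (hεδ : ε < δ) (hδ : δ < 1 / 5)
    (hv : ∀ k, 0 ≤ v k) (h0 : v 0 ≤ 1) (h1 : 1 / 2 ≤ v 1)
    (hrec : ∀ k, v (k + 1) * (1 - ε - δ * ε) - v k * (2 * (δ * ε)) ≤ v (k + 2)) (k : ℕ) :
    v 1 * (1 - ε - 5 * (δ * ε)) ^ k ≤ v (k + 1) := by
  have hδε : δ * ε ≤ 1 / 25 := by nlinarith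
  have hδε0 : 0 < δ * ε := mul_pos (hε.trans hεδ) hε
  suffices h : v k / 2 ≤ v (k + 1) ∧ v 1 * (1 - ε - 5 * (δ * ε)) ^ k ≤ v (k + 1) from h.2
  induction k with
  | zero => exact ⟨by simp only [zero_add]; linarith, by simp⟩
  | succ k ih =>
    obtain ⟨ih1, ih2⟩ := ih
    have hstep : v (k + 1) * (1 - ε - 5 * (δ * ε)) ≤ v (k + 2) := by
      have h3 : v k * (2 * (δ * ε)) ≤ (2 * v (k + 1)) * (2 * (δ * ε)) := by
        gcongr; linarith
      linarith [hrec k]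
    refine ⟨?_, ?_⟩
    · have : v (k + 1) * (1 / 2) ≤ v (k + 1) * (1 - ε - 5 * (δ * ε)) :=
        mul_le_mul_of_nonneg_left (by linarith) (hv _)
      linarith
    · rw [pow_succ, ← mul_assoc]
      exact (mul_le_mul_of_nonneg_right ih2 (by linarith)).trans hstep

/-- Taking 12 instead of 5 leaves a surplus 7δε, which absorbs the quadratic term in ε because ε <
δ. -/
lemma exp_neg_le_block {ε δ : ℝ} (hε : 0 < ε) (hεδ : ε < δ) (hδ : δ < 1 / 5) :
    Real.exp (-(ε * (1 + 12 * δ))) ≤ 1 - ε - 5 * (δ * ε) := by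
  have hδ0 : 0 < δ := hε.trans hεδ
  rw [Real.exp_neg]
  have h1 := Real.add_one_le_exp (ε * (1 + 12 * δ))
  have h2 : 0 < 1 - ε - 5 * (δ * ε) := by nlinarith
  rw [inv_le_comm₀ (Real.exp_pos _) h2]
  refine le_trans ?_ h1
  rw [inv_le_iff_one_le_mul₀ h2]
  have h3 : (1 + 12 * δ) * (1 + 5 * δ) ≤ 34 / 10 * 2 := by gcongr <;> linarith
  have h4 : ε * ((1 + 12 * δ) * (1 + 5 * δ)) ≤ 7 * δ := by nlinarith
  nlinarith

/-- The second-order term is needed: b < 1 keeps 1 + b below 2, and with 1 - p ≤ e^{-p} alone the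
rate comparison in `block_upper` would fail for ε and δ near 1/5. -/
lemma one_sub_le_exp_neg {p : ℝ} (h0 : 0 ≤ p) (h1 : p < 1) :
    1 - p ≤ Real.exp (-(p + p ^ 2 / 2)) := by
  have h := Real.hasSum_pow_div_log_of_abs_lt_one (by rwa [abs_of_nonneg h0])
  have h2 := sum_le_hasSum (Finset.range 2) (fun i _ => by positivity) h
  simp only [Finset.sum_range_succ, Finset.sum_range_zero] at h2
  norm_num at h2
  rw [← Real.log_le_iff_le_exp (by linarith)]
  linarith

/-- With p = ε(1-δ), the first two factors are (p + p²/2)/ε, the decay rate per block; the last is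
the smallest admissible m in units of t/ε. -/
lemma rate_bound {ε δ : ℝ} (hε : 0 < ε) (hεδ : ε < δ) (hδ : δ < 1 / 5) :
    1 - 19 / 10 * δ ≤
      (1 - δ) * (1 + ε * (1 - δ) / 2) * ((1 - δ * ε) * (1 - ε) - δ * ε) := by
  have hδ0 : 0 < δ := hε.trans hεδ
  have h1 : 1 - δ / 2 - 3 * δ ^ 2 + δ ^ 3 / 2 ≤
      (1 + ε * (1 - δ) / 2) * ((1 - δ * ε) * (1 - ε) - δ * ε) := by
    have e : (1 + ε * (1 - δ) / 2) * ((1 - δ * ε) * (1 - ε) - δ * ε) =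
        1 - ε * (1 + 5 * δ) / 2 - ε ^ 2 * (1 - δ - 2 * δ ^ 2) / 2 +
          δ * (1 - δ) * ε ^ 3 / 2 := by ring
    have h2 : ε * (1 + 5 * δ) ≤ δ * (1 + 5 * δ) := by gcongr
    have h3 : ε ^ 2 * (1 - δ - 2 * δ ^ 2) ≤ δ ^ 2 * (1 - δ - 2 * δ ^ 2) := by
      gcongr
      nlinarith
    have h4 : 0 ≤ δ * (1 - δ) * ε ^ 3 := by
      have : 0 ≤ 1 - δ := by linarith
      positivity
    have h5 : 0 ≤ δ ^ 4 := by positivity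
    rw [e]
    linarith
  have h2 : 1 - 19 / 10 * δ ≤ (1 - δ) * (1 - δ / 2 - 3 * δ ^ 2 + δ ^ 3 / 2) := by
    have h3 : 0 ≤ 2 / 5 - 5 / 2 * δ + 7 / 2 * δ ^ 2 - δ ^ 3 / 2 := by
      nlinarith [sq_nonneg (δ - 1 / 5), mul_pos hδ0 hδ0]
    nlinarith [mul_nonneg hδ0.le h3]
  rw [mul_assoc]
  exact h2.trans (mul_le_mul_of_nonneg_left h1 (by linarith))

end Numerics

/-! ### From block estimates to nearly exponential tails -/

section NearlyExponential

/-- The form x/(1+x) keeps the tolerance below 1 even when 1000δ exceeds 1. -/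
lemma tolerance_bounds {δ : ℝ} (hδ : 0 < δ) :
    1000 * δ / (1 + 1000 * δ) ∈ Set.Ioo (0 : ℝ) 1 ∧
      |1000 * δ / (1 + 1000 * δ)| ≤ 1000 * δ := by
  have h : (0 : ℝ) < 1 + 1000 * δ := by positivity
  have h0 : 0 < 1000 * δ / (1 + 1000 * δ) := by positivity
  refine ⟨⟨h0, (div_lt_one h).2 (by linarith)⟩, ?_⟩
  rw [abs_of_pos h0]
  exact div_le_self (by positivity) (by linarith)

/-- Strictness on the left matters: H_A ≥ s must give H_A > kw, since `noHit` excludes a visit at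
the endpoint. -/
lemma exists_block {w s : ℝ} (hw : 0 < w) (hs : 0 < s) :
    ∃ k : ℕ, k * w < s ∧ s ≤ (k + 1) * w := by
  have h0 : 0 < ⌈s / w⌉₊ := Nat.ceil_pos.2 (by positivity)
  obtain ⟨k, hk⟩ := Nat.exists_eq_succ_of_ne_zero h0.ne'
  refine ⟨k, ?_, ?_⟩
  · rw [← lt_div_iff₀ hw]
    exact Nat.lt_ceil.1 (by omega)
  · rw [← div_le_iff₀ hw]
    have := Nat.le_ceil (s / w)
    rw [hk] at this
    exact_mod_cast this

lemma block_upper {ε δ t w m α s : ℝ} {k : ℕ} (hε : 0 < ε) (hεδ : ε < δ) (hδ : δ < 1 / 5)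
    (ht : 0 < t) (hw : w ≤ t * (1 + δ))
    (hm : t / ε * ((1 - δ * ε) * (1 - ε) - δ * ε) ≤ m) (hm0 : 0 < m) (hα : 4 * ε ≤ α)
    (hs : s ≤ (k + 1) * w) :
    (1 - ε * (1 - δ)) ^ k ≤
      (1 + α) * Real.exp (-(s / ((1 + 1000 * δ / (1 + 1000 * δ)) * m))) := by
  have hδ0 : 0 < δ := hε.trans hεδ
  set p := ε * (1 - δ) with hp
  have hp0 : 0 < p := mul_pos hε (by linarith)
  have hpε : p ≤ ε := by nlinarith
  set b := 1000 * δ / (1 + 1000 * δ) with hb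
  have hb0 : 0 < b := (tolerance_bounds hδ0).1.1
  set κ := p + p ^ 2 / 2 with hκ
  have hκ0 : 0 < κ := by positivity
  have hrate : w ≤ κ * ((1 + b) * m) := by
    have h1 := rate_bound hε hεδ hδ
    have h2 : 1 + δ ≤ (1 + b) * (1 - 19 / 10 * δ) := by
      have h3 : 1 + b = (1 + 2000 * δ) / (1 + 1000 * δ) := by rw [hb]; field_simp; ring
      rw [h3, div_mul_eq_mul_div, le_div_iff₀ (by positivity)]
      nlinarith
    calc w ≤ t * (1 + δ) := hw
      _ ≤ t * ((1 + b) * ((1 - δ) * (1 + ε * (1 - δ) / 2) *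
            ((1 - δ * ε) * (1 - ε) - δ * ε))) := by
          gcongr
          exact h2.trans (mul_le_mul_of_nonneg_left h1 (by linarith))
      _ = κ * ((1 + b) * (t / ε * ((1 - δ * ε) * (1 - ε) - δ * ε))) := by
          rw [hκ, hp]; field_simp
      _ ≤ κ * ((1 + b) * m) := by gcongr
  have hexp : s / ((1 + b) * m) ≤ κ * (k + 1) := by
    rw [div_le_iff₀ (by positivity)]
    calc s ≤ (k + 1) * w := hs
      _ ≤ (k + 1) * (κ * ((1 + b) * m)) := by gcongr
      _ = _ := by ring
  have hpow : (1 - p) ^ (k + 1) ≤ Real.exp (-(κ * (k + 1))) := by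
    calc (1 - p) ^ (k + 1) ≤ Real.exp (-κ) ^ (k + 1) :=
          pow_le_pow_left₀ (by linarith) (one_sub_le_exp_neg hp0.le (by linarith)) _
      _ = _ := by rw [← Real.exp_nat_mul]; congr 1; push_cast; ring
  -- The factor 1 + α pays for the incomplete last block, that is, for k in place of k + 1.
  have h1 : 1 ≤ (1 + α) * (1 - p) := by nlinarith
  calc (1 - p) ^ k ≤ ((1 + α) * (1 - p)) * (1 - p) ^ k :=
        le_mul_of_one_le_left (pow_nonneg (by linarith) _) h1
    _ = (1 + α) * (1 - p) ^ (k + 1) := by ring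
    _ ≤ (1 + α) * Real.exp (-(κ * (k + 1))) :=
        mul_le_mul_of_nonneg_left hpow (by linarith)
    _ ≤ _ := mul_le_mul_of_nonneg_left (Real.exp_le_exp.2 (by linarith)) (by linarith)

lemma block_lower {ε δ t m s : ℝ} {k : ℕ} (hε : 0 < ε) (hεδ : ε < δ) (hδ : δ < 1 / 5)
    (ht : 0 < t) (hm : m ≤ t / ε * ((1 + δ) / (1 - δ))) (hm0 : 0 < m) (hs : k * t < s) :
    Real.exp (-(s / ((1 - 1000 * δ / (1 + 1000 * δ)) * m))) ≤
      (1 - ε - 5 * (δ * ε)) ^ k := by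
  have hδ0 : 0 < δ := hε.trans hεδ
  have hb : 1 - 1000 * δ / (1 + 1000 * δ) = 1 / (1 + 1000 * δ) := by field_simp; ring
  have h1 : ε * (1 + 12 * δ) * m ≤ (1 + 1000 * δ) * t := by
    have h2 : (1 + 12 * δ) * ((1 + δ) / (1 - δ)) ≤ 1 + 1000 * δ := by
      rw [mul_div_assoc', div_le_iff₀ (by linarith)]
      nlinarith
    calc ε * (1 + 12 * δ) * m ≤ ε * (1 + 12 * δ) * (t / ε * ((1 + δ) / (1 - δ))) := by gcongr
      _ = t * ((1 + 12 * δ) * ((1 + δ) / (1 - δ))) := by field_simp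
      _ ≤ t * (1 + 1000 * δ) := by gcongr
      _ = _ := by ring
  calc Real.exp (-(s / ((1 - 1000 * δ / (1 + 1000 * δ)) * m)))
      ≤ Real.exp (k * -(ε * (1 + 12 * δ))) := by
        rw [Real.exp_le_exp, mul_neg, neg_le_neg_iff, hb, le_div_iff₀ (by positivity)]
        rw [one_div, ← div_eq_inv_mul, mul_div_assoc', div_le_iff₀ (by positivity)]
        calc k * (ε * (1 + 12 * δ)) * m = k * (ε * (1 + 12 * δ) * m) := by ring
          _ ≤ k * ((1 + 1000 * δ) * t) := by gcongr
          _ = (k * t) * (1 + 1000 * δ) := by ring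
          _ ≤ s * (1 + 1000 * δ) := by gcongr
    _ = Real.exp (-(ε * (1 + 12 * δ))) ^ k := by rw [← Real.exp_nat_mul]
    _ ≤ _ := pow_le_pow_left₀ (Real.exp_pos _).le (exp_neg_le_block hε hεδ hδ) k

variable {E : Type*} [Fintype E] [MeasurableSpace E] [MeasurableSingletonClass E]
  {q : E → E → ℝ} {P : E → Measure (CadlagPath E)} {π μ : PMF E} {A : Set E}

/-- The hitting time is nearly exponential with any mean `m` that is close to `t / ε`. -/
lemma MixedAt.isNearlyExp (hP : IsMarkovChain q P) (hπ : IsStationaryLaw P π) {ε δ m : ℝ}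
    (hε : 0 < ε) (hεδ : ε < δ) (hδ : δ < 1 / 5) {S t : ℝ≥0} (hS : MixedAt P π (δ * ε) S)
    (hFS : hitProb P π A S ≤ δ * ε) (hFt : hitProb P π A t = ε) (ht : 0 < t)
    (hSt : (S : ℝ) ≤ δ * t)
    (hfin : ∀ y, ∫⁻ ω, hittingTime A ω ∂(P y) ≠ ∞)
    (hm : (t : ℝ) / ε * ((1 - δ * ε) * (1 - ε) - δ * ε) ≤ m)
    (hm' : m ≤ (t : ℝ) / ε * ((1 + δ) / (1 - δ))) (μ : PMF E) :
    IsNearlyExp (startedFrom P μ) (hittingTime A) m (4 * ε + 2 * hitProb P μ A S)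
      (1000 * δ / (1 + 1000 * δ)) := by
  have hδ0 : 0 < δ := hε.trans hεδ
  have ht0 : (0 : ℝ) < t := by exact_mod_cast ht
  have hr := hitProb_nonneg P μ A S
  have := hP.isProbabilityMeasure_startedFrom μ
  have hSt' : S ≤ t := by
    have : (S : ℝ) ≤ t := by nlinarith
    exact_mod_cast this
  have hm0 : 0 < m := by
    refine lt_of_lt_of_le ?_ hm
    have : 0 < (1 - δ * ε) * (1 - ε) - δ * ε := by
      have h1 : δ * ε ≤ 1 / 5 * ε := by gcongr
      have h2 : 0 ≤ δ * ε * ε := by positivity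
      linarith
    positivity
  refine ⟨hm0, by positivity, (tolerance_bounds hδ0).1, (measurable_hittingTime A).aemeasurable,
    ae_lt_top (measurable_hittingTime A) (meanHit_ne_top P μ hfin), fun s hs => ?_,
    fun s hs => ?_⟩
  -- Source of the factor 2 on r_μ: either the lower bound is trivial or r_μ < 1/2 - 2ε, and then
  -- the first block is survived with probability at least 1/2.
  · rcases le_or_gt (1 - (4 * ε + 2 * hitProb P μ A S)) 0 with h | h
    · exact (mul_nonpos_of_nonpos_of_nonneg h (Real.exp_pos _).le).trans measureReal_nonneg
    obtain ⟨k, hk1, hk2⟩ := exists_block ht0 hs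
    have h1 := hS.le_noHit (A := A) hP hSt' μ
    rw [hFt] at h1
    have hgeom := geometric_lower_bound hε hεδ hδ
      (v := fun k => (startedFrom P μ).real (noHit A (k * t)))
      (fun _ => measureReal_nonneg) measureReal_le_one
      (by simp only [Nat.cast_one, one_mul]; nlinarith)
      (fun k => by
        have h2 := hS.noHit_recursion (A := A) hP hπ hSt' μ k
        rw [hFt] at h2
        refine le_trans ?_ h2
        gcongr
        linarith) k
    simp only [Nat.cast_one, one_mul] at hgeom
    calc (1 - (4 * ε + 2 * hitProb P μ A S)) * _
        ≤ (startedFrom P μ).real (noHit A t) * (1 - ε - 5 * (δ * ε)) ^ k := by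
          refine mul_le_mul ?_ (block_lower hε hεδ hδ ht0 hm' hm0 hk1) (Real.exp_pos _).le
            measureReal_nonneg
          nlinarith
      _ ≤ _ := hgeom
      _ ≤ _ := by
          refine measureReal_mono fun ω hω => ?_
          rw [mem_noHit_iff_lt] at hω
          refine le_trans ?_ hω.le
          refine ENNReal.ofReal_le_of_le_toReal ?_
          rw [ENNReal.coe_toReal]
          push_cast
          exact hk2
  · have hw0 : (0 : ℝ) < (S + t : ℝ≥0) := by push_cast; positivity
    obtain ⟨k, hk1, hk2⟩ := exists_block hw0 hs
    have hone : ∀ y, (P y).real (noHit A (S + t)) ≤ 1 - ε * (1 - δ) := fun y => by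
      have := hS.noHit_add_le hP A t y
      rw [hFt] at this
      linarith
    calc _ ≤ (startedFrom P μ).real (noHit A (k * (S + t))) := by
          refine measureReal_mono fun ω hω => ?_
          rw [mem_noHit_iff_lt]
          refine lt_of_lt_of_le ?_ hω
          rw [ENNReal.lt_ofReal_iff_toReal_lt ENNReal.coe_ne_top, ENNReal.coe_toReal]
          push_cast at hk1 ⊢
          exact hk1
      _ ≤ (1 - ε * (1 - δ)) ^ k := hP.noHit_mul_le hone μ k
      _ ≤ _ := block_upper hε hεδ hδ ht0 (by push_cast; nlinarith) hm hm0 (by linarith) hk2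

/-- The stationary mean hitting time is close to `t / ε`. -/
lemma MixedAt.meanHit_bounds (hP : IsMarkovChain q P) (hπ : IsStationaryLaw P π) {ε δ : ℝ}
    (hε : 0 < ε) (hεδ : ε < δ) (hδ : δ < 1 / 5) {S t : ℝ≥0} (hS : MixedAt P π (δ * ε) S)
    (hFt : hitProb P π A t = ε) (ht : 0 < t) (hSt : (S : ℝ) ≤ δ * t) :
    (∀ y, ∫⁻ ω, hittingTime A ω ∂(P y) ≠ ∞) ∧
      (t : ℝ) / ε * ((1 - δ * ε) * (1 - ε) - δ * ε) ≤ (meanHit P π A).toReal ∧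
      (meanHit P π A).toReal ≤ (t : ℝ) / ε * ((1 + δ) / (1 - δ)) := by
  have hδ0 : 0 < δ := hε.trans hεδ
  have hδ1 : 0 < 1 - δ := by linarith
  have ht0 : (0 : ℝ) < t := by exact_mod_cast ht
  have hle := hP.lintegral_hittingTime_le (A := A) (w := S + t) (p := ε * (1 - δ))
    (by positivity) (mul_pos hε hδ1) fun y => by
      have := hS.noHit_add_le hP A t y
      rw [hFt] at this
      linarith
  have hfin : ∀ y, ∫⁻ ω, hittingTime A ω ∂(P y) ≠ ∞ := fun y =>
    ((hle y).trans_lt ENNReal.ofReal_lt_top).ne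
  refine ⟨hfin, ?_, ?_⟩
  · obtain ⟨x₀, -⟩ := π.support_nonempty
    have : Nonempty E := ⟨x₀⟩
    obtain ⟨x, hx⟩ := Finite.exists_max fun y => (∫⁻ ω, hittingTime A ω ∂(P y)).toReal
    have h1 := hS.mul_mean_le hP hfin hx x rfl
    have h2 := hπ.le_mul_mean hP hfin hx t
    rw [hFt] at h2
    set K := (∫⁻ ω, hittingTime A ω ∂(P x)).toReal
    have h3 : (t : ℝ) / ε * (1 - ε) ≤ K := by
      rw [div_mul_eq_mul_div, div_le_iff₀ hε]
      linarith
    have h4 : (1 - δ * ε) * ((t : ℝ) / ε * (1 - ε)) ≤ (1 - δ * ε) * K :=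
      mul_le_mul_of_nonneg_left h3 (by nlinarith)
    have h5 : (t : ℝ) / ε * (δ * ε) = δ * t := by field_simp
    linarith
  · have h1 := ENNReal.toReal_mono ENNReal.ofReal_ne_top (meanHit_le P π hle)
    rw [ENNReal.toReal_ofReal (by positivity)] at h1
    refine h1.trans ?_
    rw [div_mul_div_comm]
    push_cast
    gcongr
    linarith

end NearlyExponential

/-! ### The main theorem -/

theorem mainTheorem5 :
    ∃ C : ℝ, 0 < C ∧
      ∀ (E : Type*) [Fintype E] [MeasurableSpace E] [MeasurableSingletonClass E]
        (q : E → E → ℝ) (P : E → Measure (CadlagPath E)) (π : PMF E) (A : Set E) (ε δ : ℝ),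
        IsMarkovChain q P → IsMixing P π → 0 < π.toMeasure A →
        0 < ε → ε < δ → δ < 1 / 5 →
        hitProb P π A (mixingTime P π (δ * ε)) ≤ δ * ε →
        (∃! t : ℝ≥0, hitProb P π A t = ε) ∧
        ∀ t : ℝ≥0, hitProb P π A t = ε →
          (∀ μ : PMF E, ∃ a b : ℝ, |a| ≤ C * ε ∧ |b| ≤ C * δ ∧
            IsNearlyExp (startedFrom P μ) (CadlagPath.hittingTime A) ((t : ℝ) / ε)
              (a + 2 * hitProb P μ A (mixingTime P π (δ * ε))) b) ∧
          (0 < t ∧ meanHit P π A < ∞ ∧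
            |ε * (meanHit P π A).toReal / (t : ℝ) - 1| ≤ C * δ) ∧
          (∀ μ : PMF E, ∃ a b : ℝ, |a| ≤ C * ε ∧ |b| ≤ C * δ ∧
            IsNearlyExp (startedFrom P μ) (CadlagPath.hittingTime A) (meanHit P π A).toReal
              (a + 2 * hitProb P μ A (mixingTime P π (δ * ε))) b) := by
  refine ⟨1000, by norm_num, ?_⟩
  intro E _ _ _ q P π A ε δ hP hmix hA hε hεδ hδ hFS
  have hδ0 : 0 < δ := hε.trans hεδ
  have hδε : δ * ε < ε := by nlinarith
  have hδε0 : 0 < δ * ε := mul_pos hδ0 hε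
  have hπ := hmix.stationary
  have hS := hmix.mixedAt_mixingTime hP (a := δ * ε) ⟨hδε0, by linarith⟩
  set S := mixingTime P π (δ * ε)
  have hF0 : hitProb P π A 0 ≤ δ * ε := (hitProb_mono hP π A zero_le).trans hFS
  refine ⟨hmix.existsUnique_hitProb_eq hP hA (hF0.trans hδε.le) (by linarith), fun t hFt => ?_⟩
  have hlt : S < t := by
    by_contra! h
    linarith [hitProb_mono hP π A h]
  have ht : 0 < t := zero_le.trans_lt hlt
  have ht0 : (0 : ℝ) < t := by exact_mod_cast ht
  -- Monotonicity of F(t)/t gives S ε ≤ t F(S) ≤ t δε.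
  have hSt : (S : ℝ) ≤ δ * t := by
    have h1 := hπ.mul_hitProb_le hP A hlt.le
    rw [hFt] at h1
    have h2 : (t : ℝ) * hitProb P π A S ≤ t * (δ * ε) := by gcongr
    refine le_of_mul_le_mul_right ?_ hε
    linarith
  obtain ⟨hfin, hM1, hM2⟩ := hS.meanHit_bounds hP hπ hε hεδ hδ hFt ht hSt
  have ha : |4 * ε| ≤ 1000 * ε := by rw [abs_of_pos (by positivity)]; linarith
  have hb := (tolerance_bounds hδ0).2
  have hratio : (1 + δ) / (1 - δ) ≤ 1 + 3 * δ := by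
    rw [div_le_iff₀ (by linarith)]
    nlinarith
  refine ⟨fun μ => ⟨4 * ε, _, ha, hb, ?_⟩, ⟨ht, (meanHit_ne_top P π hfin).lt_top, ?_⟩,
    fun μ => ⟨4 * ε, _, ha, hb, ?_⟩⟩
  -- The value t/ε lies in the admissible window because its lower factor is at most 1 and its upper
  -- factor at least 1.
  · refine hS.isNearlyExp hP hπ hε hεδ hδ hFS hFt ht hSt hfin ?_ ?_ μ
    · exact mul_le_of_le_one_right (by positivity) (by nlinarith)
    · refine le_mul_of_one_le_right (by positivity) ?_
      rw [one_le_div (by linarith)]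
      linarith
  · have e : ε * (meanHit P π A).toReal / t = (meanHit P π A).toReal / (t / ε) := by field_simp
    have hm : (0 : ℝ) < t / ε := by positivity
    rw [mul_comm] at hM1 hM2
    rw [← le_div_iff₀ hm, ← e] at hM1
    rw [← div_le_iff₀ hm, ← e] at hM2
    rw [abs_le]
    constructor <;> nlinarith
  · exact hS.isNearlyExp hP hπ hε hεδ hδ hFS hFt ht hSt hfin hM1 hM2 μ
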